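/- Let $d\in\mathbb N$ and $s\in\mathbb R$ satisfy $0<s<d/2$ and $s\le 1$. For $u\in L^2(\mathbb R^n;\mathbb C)$ let $\widehat u(p)=(2\pi)^{-n/2}\int_{\mathbb R^n}u(x)e^{-ip\cdot x}\,dx$ be its unitary ($L^2$) Fourier transform, put $\langle u,(-\Delta)^su\rangle:=\int_{\mathbb R^n}|p|^{2s}|\widehat u(p)|^2\,dp\in[0,\infty]$, and let $H^s(\mathbb R^n)$ be the set of $u\in L^2(\mathbb R^n;\mathbb C)$ for which this is finite. For $\Psi\in L^2(\mathbb R^{dN};\mathbb C)$, with variables $x=(x_1,\dots,x_N)$, $x_i\in\mathbb R^d$, and dual variables $p=(p_1,\dots,p_N)$, put $$\Big\langle\Psi,\sum_{i=1}^N(-\Delta_i)^s\Psi\Big\rangle:=\sum_{i=1}^N\int_{\mathbb R^{dN}}|p_i|^{2s}|\widehat\Psi(p)|^2\,dp,\qquad \rho_\Psi(x):=\sum_{j=1}^N\int_{\mathbb R^{d(N-1)}}|\Psi(x_1,\dots,x_{j-1},x,x_{j+1},\dots,x_N)|^2\prod_{i\ne j}dx_i .$$ Then the following two statements are equivalent.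 (a) (Many-body fractional Lieb–Thirring inequality.) There is a constant $C>0$, depending only on $d$ and $s$, such that for all integers $N\ge1$ and all $\Psi\in H^s(\mathbb R^{dN})$ with $\|\Psi\|_{L^2}=1$ (no symmetry of $\Psi$ is assumed), $$\Big\langle\Psi,\sum_{i=1}^N(-\Delta_i)^s\Psi\Big\rangle+\sum_{1\le i<j\le N}\int_{\mathbb R^{dN}}\frac{|\Psi(x)|^2}{|x_i-x_j|^{2s}}\,dx\ \ge\ C\int_{\mathbb R^d}\rho_\Psi(x)^{1+2s/d}\,dx .$$ (b) (One-body interpolation inequality.) There is a constant $C>0$, depending only on $d$ and $s$, such that for all $u\in H^s(\mathbb R^d)$, $$\langle u,(-\Delta)^su\rangle^{1-2s/d}\Big(\iint_{\mathbb R^d\times\mathbb R^d}\frac{|u(x)|^2|u(y)|^2}{|x-y|^{2s}}\,dx\,dy\Big)^{2s/d}\ \ge\ C\int_{\mathbb R^d}|u(x)|^{2(1+2s/d)}\,dx .$$ -/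

import Mathlib

open MeasureTheory
open scoped ENNReal FourierTransform

noncomputable section

namespace FracLT

/-- One-body space `ℝ^d`, with the Euclidean norm and Lebesgue measure. -/
abbrev Space (d : ℕ) : Type := EuclideanSpace ℝ (Fin d)

/-- `N`-body configuration space `ℝ^{dN}`; the coordinate `(i, k)` is the `k`-th coordinate of the
`i`-th particle. -/
abbrev Config (N d : ℕ) : Type := EuclideanSpace ℝ (Fin N × Fin d)

/-- The position `x_i ∈ ℝ^d` of the `i`-th particle in the configuration `x`. -/
def particle {N d : ℕ} (i : Fin N) (x : Config N d) : Space d :=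
  WithLp.toLp 2 fun k => x (i, k)

/-- The configuration `(y_1, …, y_N) ∈ ℝ^{dN}` assembled from the particle positions. -/
def assemble {N d : ℕ} (y : Fin N → Space d) : Config N d :=
  WithLp.toLp 2 fun ik => y ik.1 ik.2

/-- `L²(E; ℂ)` with respect to Lebesgue measure. -/
abbrev L2 (E : Type*) [NormedAddCommGroup E] [InnerProductSpace ℝ E] [FiniteDimensional ℝ E]
    [MeasurableSpace E] [BorelSpace E] : Type _ :=
  Lp (α := E) ℂ 2 (volume : Measure E)

section Form

variable {E : Type*} [NormedAddCommGroup E] [InnerProductSpace ℝ E] [FiniteDimensional ℝ E]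
  [MeasurableSpace E] [BorelSpace E]

/-- `⟨u, (-Δ)^s u⟩ = ∫ |p|^{2s} |û(p)|² dp ∈ [0, ∞]` for `u ∈ L²(E)`, with `û` the unitary Fourier
transform for the phase `e^{-i p·x}`. Since `𝓕` uses the phase `e^{-2πi ξ·x}`, the substitution
`p = 2πξ` turns the symbol into `(2π|ξ|)^{2s}`. -/
def fracForm (s : ℝ) (u : L2 E) : ℝ≥0∞ :=
  ∫⁻ ξ : E, ENNReal.ofReal ((2 * Real.pi * ‖ξ‖) ^ (2 * s)) * ‖(𝓕 u) ξ‖ₑ ^ 2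

/-- `u ∈ H^s(E)`, for `u ∈ L²(E)` and `s > 0`: the norm
`‖u‖_{L²}² + ⟨u, (-Δ)^s u⟩` is finite. -/
def MemHs (s : ℝ) (u : L2 E) : Prop :=
  fracForm s u < ∞

end Form

/-- `∬ |u(x)|² |u(y)|² / |x - y|^{2s} dx dy ∈ [0, ∞]`. -/
def rieszEnergy {d : ℕ} (s : ℝ) (u : L2 (Space d)) : ℝ≥0∞ :=
  ∫⁻ x : Space d, ∫⁻ y : Space d, ‖u x‖ₑ ^ 2 * ‖u y‖ₑ ^ 2 / ‖x - y‖ₑ ^ (2 * s)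

/-- `⟨Ψ, ∑_i (-Δ_i)^s Ψ⟩ ∈ [0, ∞]`, where `(-Δ_i)^s` is multiplication by `|p_i|^{2s}` in Fourier
space (with `p = 2πξ` as in `fracForm`). -/
def kineticEnergy {N d : ℕ} (s : ℝ) (Ψ : L2 (Config N d)) : ℝ≥0∞ :=
  ∑ i : Fin N, ∫⁻ ξ : Config N d,
    ENNReal.ofReal ((2 * Real.pi * ‖particle i ξ‖) ^ (2 * s)) * ‖(𝓕 Ψ) ξ‖ₑ ^ 2

/-- `⟨Ψ, ∑_{i<j} |x_i - x_j|^{-2s} Ψ⟩ ∈ [0, ∞]`. -/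
def interactionEnergy {N d : ℕ} (s : ℝ) (Ψ : L2 (Config N d)) : ℝ≥0∞ :=
  ∑ i : Fin N, ∑ j ∈ Finset.Ioi i, ∫⁻ x : Config N d,
    ‖Ψ x‖ₑ ^ 2 / ‖particle i x - particle j x‖ₑ ^ (2 * s)

/-- The one-body density
`ρ_Ψ(x) = ∑_i ∫ |Ψ(x_1, …, x_{i-1}, x, x_{i+1}, …, x_N)|² ∏_{j ≠ i} dx_j`. -/
def density {N d : ℕ} (Ψ : L2 (Config N d)) (x : Space d) : ℝ≥0∞ :=
  ∑ i : Fin N,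
    lmarginal (fun _ : Fin N => (volume : Measure (Space d))) {i}ᶜ
      (fun y => ‖Ψ (assemble y)‖ₑ ^ 2) (fun _ => x)

end FracLT

end

/-!
Write `θ = 2s/d < 1`. The two inequalities are compared through the increments
`diffSq h u = ∫ |u(x + h) - u(x)|² dx`. By Plancherel (`diffSq_eq_lintegral_fourier`) the symbol of
`u ↦ diffSq (t v) u` is `2 - 2 cos (2π t ⟨v, ξ⟩)`. Integrating it against `t^{-1-2s} dt` for `s < 1`,
or letting `t → 0` for `s = 1`, recovers the form `dirForm s v` with symbol `|2π ⟨v, ξ⟩|^{2s}`. Hence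
an inequality between increments is inherited by these forms (`dirForm_le_sum_of_diffSq_le`), and
summing over coordinate directions controls the fractional kinetic energies up to the factor `d`.
The restriction `s ≤ 1` enters here, and no Fourier transform other than that of a translate is ever
computed.

*Many-body to one-body* (`interpolation_of_liebThirring`). For a normalised `w` the tensor power
`w^{⊗N}` has density `N |w|²`, kinetic energy at most `d N ⟨w, (-Δ)^s w⟩`, and interaction energy at
most `N (N - 1)` times the Riesz energy of `w`. Optimising over `N`
(`le_rpow_mul_rpow_of_forall_nat`) gives the product form of the one-body inequality.

*One-body to many-body* (`liebThirring_of_interpolation`). The one-body inequality is applied to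
`u = min(√ρ_Ψ, M)`. A Hoffmann-Ostenhof type inequality (`fracForm_truncRootL2_le`) bounds the
kinetic energy of `u` by that of `Ψ`: by Minkowski's inequality increments of `√ρ_Ψ` are dominated by
those of `Ψ`, and truncation only decreases them. A Lieb–Oxford type inequality
(`exists_riesz_le_interactionEnergy_add`) bounds the Riesz energy of `u` by the interaction energy
plus `∫ |u|^{2(1+θ)}`: the kernel `|x - y|^{-2s}` is comparable to an average of `1_B(x) 1_B(y)` over
balls `B`, the expected number of pairs in `B` is bounded below through the second moment of the
number of particles in `B`, and the remaining self-energy is local (`ballAverage_min_le`). Since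
`θ < 1`, the local term can be absorbed (`le_mul_add_of_mul_le_rpow_mul_rpow`); it is finite
because `u` is bounded, and `M → ∞` concludes.
-/

noncomputable section

namespace FracLT

/-! ### Increments and the Fourier transform -/

section Fourier

variable {E : Type*} [NormedAddCommGroup E] [InnerProductSpace ℝ E] [FiniteDimensional ℝ E]
  [MeasurableSpace E] [BorelSpace E]

/-- The squared `L²` modulus of continuity `∫ |f(x + h) - f(x)|² dx`. -/
def diffSq (h : E) (f : E → ℂ) : ℝ≥0∞ := ∫⁻ x, ‖f (x + h) - f x‖ₑ ^ 2

/-- The quadratic form of the symbol `|⟨v, p⟩|^{2s}`, the fractional derivative of order `s` in the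
direction `v`, with `p = 2πξ`. -/
def dirForm (s : ℝ) (v : E) (u : L2 E) : ℝ≥0∞ :=
  ∫⁻ ξ : E, ENNReal.ofReal (|2 * Real.pi * inner ℝ v ξ| ^ (2 * s)) * ‖(𝓕 u) ξ‖ₑ ^ 2

/-- The translate `u(· + h)` as an element of `L²`. -/
def translate (h : E) (u : L2 E) : L2 E :=
  Lp.compMeasurePreserving (· + h) (measurePreserving_add_right volume h) u

lemma coeFn_translate (h : E) (u : L2 E) : translate h u =ᵐ[volume] fun x => u (x + h) :=
  Lp.coeFn_compMeasurePreserving u _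

lemma continuous_translate (h : E) : Continuous (translate h : L2 E → L2 E) :=
  (Lp.isometry_compMeasurePreserving _).continuous

lemma memLp_phase (h : E) :
    MemLp (fun ξ : E => ((Real.fourierChar (inner ℝ h ξ) : Circle) : ℂ)) ∞ volume := by
  refine memLp_top_of_bound ?_ 1 (.of_forall fun ξ => (Circle.norm_coe _).le)
  have : Continuous fun ξ : E => ((Real.fourierChar (inner ℝ h ξ) : Circle) : ℂ) := by
    have := Real.continuous_fourierChar
    fun_prop
  exact this.aestronglyMeasurable

/-- Multiplication by the character `ξ ↦ e^{2πi⟨h, ξ⟩}` on `L²`. -/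
def phaseMul (h : E) : L2 E →L[ℂ] L2 E :=
  (ContinuousLinearMap.mul ℂ ℂ).holderL volume ∞ 2 2 ((memLp_phase h).toLp _)

lemma coeFn_phaseMul (h : E) (u : L2 E) :
    phaseMul h u =ᵐ[volume] fun ξ => ((Real.fourierChar (inner ℝ h ξ) : Circle) : ℂ) * u ξ := by
  have h1 := (ContinuousLinearMap.mul ℂ ℂ).coeFn_holder (r := 2) ((memLp_phase h).toLp _) u
  have h2 := (memLp_phase h).coeFn_toLp
  filter_upwards [h1, h2] with ξ h1 h2
  rw [← h2]
  exact h1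

/-- Checked on Schwartz functions by a change of variables and extended to `L²` by density. -/
lemma fourier_translate (h : E) (u : L2 E) : 𝓕 (translate h u) = phaseMul h (𝓕 u) := by
  have hF : Continuous (𝓕 : L2 E → L2 E) := (Lp.fourierTransformₗᵢ E ℂ).continuous
  refine DenseRange.induction_on (p := fun u : L2 E => 𝓕 (translate h u) = phaseMul h (𝓕 u))
    (SchwartzMap.denseRange_toLpCLM (E := E) (F := ℂ) (p := 2) (μ := volume) ENNReal.ofNat_ne_top)
    u ?_ ?_
  · exact isClosed_eq (hF.comp (continuous_translate h)) ((phaseMul h).continuous.comp hF)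
  · intro f
    have e1 : translate h (SchwartzMap.toLpCLM ℝ ℂ 2 volume f)
        = (f.compSubConstCLM ℂ (-h)).toLp 2 := by
      apply Lp.ext
      refine (coeFn_translate h _).trans ?_
      have h1 := (measurePreserving_add_right (volume : Measure E) h).quasiMeasurePreserving.ae
        (f.coeFn_toLp 2 volume)
      filter_upwards [h1, (f.compSubConstCLM ℂ (-h)).coeFn_toLp 2 volume] with x h1 h2
      rw [h2, SchwartzMap.compSubConstCLM_apply, sub_neg_eq_add]
      exact h1
    have e2 : SchwartzMap.toLpCLM ℝ ℂ 2 volume f = f.toLp 2 := rfl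
    rw [e1, e2, SchwartzMap.toLp_fourier_eq, SchwartzMap.toLp_fourier_eq]
    apply Lp.ext
    refine (SchwartzMap.coeFn_toLp _ 2 volume).trans ?_
    filter_upwards [coeFn_phaseMul h ((𝓕 f).toLp 2), (𝓕 f).coeFn_toLp 2 volume] with ξ h1 h2
    rw [h1, h2, SchwartzMap.fourier_coe, SchwartzMap.fourier_coe]
    have := congrFun (VectorFourier.fourierIntegral_comp_add_right Real.fourierChar
      (volume : Measure E) (innerₗ E) (f : E → ℂ) h) ξ
    have e3 : ((f.compSubConstCLM ℂ (-h) : SchwartzMap E ℂ) : E → ℂ) = f ∘ fun v => v + h := by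
      ext x; simp
    rw [e3]
    exact this

lemma enorm_sq_eq_lintegral (u : L2 E) : ‖u‖ₑ ^ 2 = ∫⁻ x, ‖u x‖ₑ ^ 2 := by
  rw [Lp.enorm_def, eLpNorm_eq_lintegral_rpow_enorm_toReal (by norm_num) (by norm_num)]
  simp only [ENNReal.toReal_ofNat, ENNReal.rpow_ofNat]
  rw [← ENNReal.rpow_natCast, ← ENNReal.rpow_mul]
  norm_num

lemma enorm_phase_sub_one_sq (θ : ℝ) :
    ‖((Real.fourierChar θ : Circle) : ℂ) - 1‖ₑ ^ 2
      = ENNReal.ofReal (2 - 2 * Real.cos (2 * Real.pi * θ)) := by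
  rw [← ofReal_norm, ← ENNReal.ofReal_pow (norm_nonneg _), Real.fourierChar_apply,
    ← Complex.normSq_eq_norm_sq]
  congr 1
  generalize 2 * Real.pi * θ = φ
  rw [Complex.exp_mul_I, ← Complex.ofReal_cos, ← Complex.ofReal_sin, Complex.normSq_apply]
  simp only [Complex.sub_re, Complex.add_re, Complex.ofReal_re, Complex.mul_re, Complex.I_re,
    Complex.ofReal_im, Complex.I_im, Complex.one_re, Complex.sub_im, Complex.add_im,
    Complex.mul_im, Complex.one_im]
  nlinarith [Real.sin_sq_add_cos_sq φ]

/-- Plancherel's identity for the increments `u(· + h) - u`. -/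
lemma diffSq_eq_lintegral_fourier (h : E) (u : L2 E) :
    diffSq h u = ∫⁻ ξ, ENNReal.ofReal (2 - 2 * Real.cos (2 * Real.pi * inner ℝ h ξ))
      * ‖(𝓕 u) ξ‖ₑ ^ 2 := by
  have h1 : diffSq h u = ‖translate h u - u‖ₑ ^ 2 := by
    rw [enorm_sq_eq_lintegral, diffSq]
    refine lintegral_congr_ae ?_
    filter_upwards [Lp.coeFn_sub (translate h u) u, coeFn_translate h u] with x h1 h2
    rw [h1, Pi.sub_apply, h2]
  have h2 : ‖translate h u - u‖ₑ = ‖𝓕 (translate h u - u)‖ₑ := by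
    rw [← ofReal_norm, ← ofReal_norm, Lp.norm_fourier_eq]
  have h3 : 𝓕 (translate h u - u) = phaseMul h (𝓕 u) - 𝓕 u := by
    rw [← fourier_translate]
    exact (Lp.fourierTransformₗᵢ E ℂ).map_sub _ _
  rw [h1, h2, h3, enorm_sq_eq_lintegral]
  refine lintegral_congr_ae ?_
  filter_upwards [Lp.coeFn_sub (phaseMul h (𝓕 u)) (𝓕 u), coeFn_phaseMul h (𝓕 u)] with ξ h1 h2
  rw [h1, Pi.sub_apply, h2, ← enorm_phase_sub_one_sq, ← mul_pow, ← enorm_mul, sub_mul, one_mul]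

end Fourier

/-! ### Directional forms as averages of increments -/

section PowerIntegrals

lemma lintegral_Ioi_rpow {p a : ℝ} (hp : 0 < p) (ha : 0 < a) :
    ∫⁻ t in Set.Ioi a, ENNReal.ofReal (t ^ (-1 - p)) = ENNReal.ofReal (a ^ (-p) / p) := by
  rw [← ofReal_integral_eq_lintegral_ofReal (integrableOn_Ioi_rpow_of_lt (by linarith) ha),
    integral_Ioi_rpow_of_lt (by linarith) ha]
  · congr 1
    rw [show -1 - p + 1 = -p by ring, neg_div_neg_eq]
  · filter_upwards [ae_restrict_mem measurableSet_Ioi] with t ht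
    exact Real.rpow_nonneg (ha.trans ht).le _

lemma lintegral_Ioc_rpow {p a : ℝ} (hp : 0 < p) (ha : 0 ≤ a) :
    ∫⁻ t in Set.Ioc 0 a, ENNReal.ofReal (t ^ (p - 1)) = ENNReal.ofReal (a ^ p / p) := by
  have hi : IntervalIntegrable (fun t : ℝ => t ^ (p - 1)) volume 0 a :=
    intervalIntegral.intervalIntegrable_rpow' (by linarith)
  rw [← ofReal_integral_eq_lintegral_ofReal
    ((intervalIntegrable_iff_integrableOn_Ioc_of_le ha).1 hi),
    ← intervalIntegral.integral_of_le ha, integral_rpow (Or.inl (by linarith))]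
  · congr 1
    rw [sub_add_cancel, Real.zero_rpow hp.ne', sub_zero]
  · filter_upwards [ae_restrict_mem measurableSet_Ioc] with t ht
    exact Real.rpow_nonneg ht.1.le _

/-- The constant `∫₀^∞ |e^{it} - 1|² t^{-1-2s} dt` relating `|a|^{2s}` to increments; it is finite
only for `s < 1`. -/
def incrementConst (s : ℝ) : ℝ≥0∞ :=
  ∫⁻ t in Set.Ioi (0 : ℝ), ENNReal.ofReal (t ^ (-1 - 2 * s)) * ENNReal.ofReal (2 - 2 * Real.cos t)

lemma two_sub_two_cos_le_sq (x : ℝ) : 2 - 2 * Real.cos x ≤ x ^ 2 := by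
  linarith [Real.one_sub_sq_div_two_le_cos (x := x)]

lemma incrementConst_ne_top {s : ℝ} (hs : 0 < s) (hs1 : s < 1) : incrementConst s ≠ ∞ := by
  unfold incrementConst
  rw [← Set.Ioc_union_Ioi_eq_Ioi (zero_le_one (α := ℝ)),
    lintegral_union measurableSet_Ioi (Set.Ioc_disjoint_Ioi le_rfl)]
  refine (ENNReal.add_lt_top.2 ⟨?_, ?_⟩).ne
  · calc _ ≤ ∫⁻ t in Set.Ioc (0 : ℝ) 1, ENNReal.ofReal (t ^ ((2 - 2 * s) - 1)) := by
          refine setLIntegral_mono (by fun_prop) fun t ht => ?_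
          rw [← ENNReal.ofReal_mul (Real.rpow_nonneg ht.1.le _)]
          refine ENNReal.ofReal_le_ofReal ?_
          calc t ^ (-1 - 2 * s) * (2 - 2 * Real.cos t) ≤ t ^ (-1 - 2 * s) * t ^ 2 :=
                mul_le_mul_of_nonneg_left (two_sub_two_cos_le_sq t) (Real.rpow_nonneg ht.1.le _)
            _ = _ := by
                rw [← Real.rpow_natCast, ← Real.rpow_add ht.1]
                congr 1
                push_cast
                ring
      _ < ∞ := by
          rw [lintegral_Ioc_rpow (by linarith) zero_le_one]
          exact ENNReal.ofReal_lt_top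
  · calc _ ≤ ∫⁻ t in Set.Ioi (1 : ℝ), ENNReal.ofReal (t ^ (-1 - 2 * s)) * ENNReal.ofReal 4 := by
          refine setLIntegral_mono (by fun_prop) fun t ht => ?_
          gcongr
          linarith [Real.neg_one_le_cos t]
      _ < ∞ := by
          rw [lintegral_mul_const _ (by fun_prop), lintegral_Ioi_rpow (by linarith) one_pos]
          exact ENNReal.mul_lt_top ENNReal.ofReal_lt_top ENNReal.ofReal_lt_top

lemma incrementConst_ne_zero (s : ℝ) : incrementConst s ≠ 0 := by
  unfold incrementConst
  intro h
  rw [lintegral_eq_zero_iff (by fun_prop)] at h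
  have h2 := ae_restrict_of_ae_restrict_of_subset
    (Set.Ioo_subset_Ioi_self : Set.Ioo (0 : ℝ) Real.pi ⊆ _) h
  have h3 : ∀ᵐ t ∂(volume.restrict (Set.Ioo (0 : ℝ) Real.pi)), False := by
    filter_upwards [h2, ae_restrict_mem measurableSet_Ioo] with t ht hm
    have hc : Real.cos t < 1 := by
      have := Real.cos_lt_cos_of_nonneg_of_le_pi le_rfl hm.2.le hm.1
      simpa using this
    have h4 : ENNReal.ofReal (t ^ (-1 - 2 * s)) * ENNReal.ofReal (2 - 2 * Real.cos t) = 0 := ht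
    rw [mul_eq_zero, ENNReal.ofReal_eq_zero, ENNReal.ofReal_eq_zero] at h4
    rcases h4 with h4 | h4
    · exact absurd (Real.rpow_pos_of_pos hm.1 _) (not_lt.2 h4)
    · linarith
  rw [Filter.eventually_false_iff_eq_bot, ae_eq_bot, Measure.restrict_eq_zero, Real.volume_Ioo,
    sub_zero, ENNReal.ofReal_eq_zero] at h3
  linarith [Real.pi_pos]

/-- Scaling turns the increment symbols into the power `|a|^{2s}`. -/
lemma lintegral_increment_symbol {s : ℝ} (hs : 0 < s) (a : ℝ) :
    ∫⁻ t in Set.Ioi (0 : ℝ), ENNReal.ofReal (t ^ (-1 - 2 * s))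
        * ENNReal.ofReal (2 - 2 * Real.cos (t * a))
      = incrementConst s * ENNReal.ofReal (|a| ^ (2 * s)) := by
  rcases eq_or_ne a 0 with rfl | ha
  · simp [Real.zero_rpow (mul_pos two_pos hs).ne']
  set b := |a| with hb
  have hb0 : 0 < b := abs_pos.2 ha
  have him : (fun t : ℝ => t * b) '' Set.Ioi 0 = Set.Ioi 0 := by
    ext y
    refine ⟨?_, fun hy => ⟨y / b, div_pos hy hb0, div_mul_cancel₀ y hb0.ne'⟩⟩
    rintro ⟨x, hx, rfl⟩
    exact mul_pos hx hb0
  have key := lintegral_image_eq_lintegral_abs_deriv_mul (measurableSet_Ioi (a := (0 : ℝ)))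
    (f := fun t => t * b) (f' := fun _ => b)
    (fun x _ => by simpa using ((hasDerivAt_id x).mul_const b).hasDerivWithinAt)
    (mul_left_injective₀ hb0.ne').injOn
    (fun t => ENNReal.ofReal (t ^ (-1 - 2 * s)) * ENNReal.ofReal (2 - 2 * Real.cos t))
  rw [him] at key
  rw [incrementConst, key, ← lintegral_mul_const _ (by fun_prop)]
  refine setLIntegral_congr_fun measurableSet_Ioi fun t ht => ?_
  have ht : 0 < t := ht
  have hcos : Real.cos (t * b) = Real.cos (t * a) := by
    rw [← Real.cos_abs (t * a), abs_mul, abs_of_pos ht]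
  have hpow : ENNReal.ofReal |b| * ENNReal.ofReal ((t * b) ^ (-1 - 2 * s))
      * ENNReal.ofReal (b ^ (2 * s)) = ENNReal.ofReal (t ^ (-1 - 2 * s)) := by
    rw [← ENNReal.ofReal_mul (abs_nonneg _), ← ENNReal.ofReal_mul (by positivity)]
    congr 1
    rw [abs_of_pos hb0, Real.mul_rpow ht.le hb0.le]
    calc b * (t ^ (-1 - 2 * s) * b ^ (-1 - 2 * s)) * b ^ (2 * s)
        = t ^ (-1 - 2 * s) * (b ^ (1 : ℝ) * b ^ (-1 - 2 * s) * b ^ (2 * s)) := by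
          rw [Real.rpow_one]; ring
      _ = _ := by
          rw [← Real.rpow_add hb0, ← Real.rpow_add hb0]
          ring_nf
          simp
  simp only [hcos]
  rw [← hpow]
  ring

end PowerIntegrals

section Comparison

variable {E : Type*} [NormedAddCommGroup E] [InnerProductSpace ℝ E] [FiniteDimensional ℝ E]
  [MeasurableSpace E] [BorelSpace E]
  {E' : Type*} [NormedAddCommGroup E'] [InnerProductSpace ℝ E'] [FiniteDimensional ℝ E']
  [MeasurableSpace E'] [BorelSpace E']

lemma measurable_enorm_sq_L2 (u : L2 E) : Measurable fun x => ‖u x‖ₑ ^ 2 :=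
  ((Lp.stronglyMeasurable u).measurable.enorm).pow_const 2

lemma diffSq_smul_eq_lintegral_fourier (t : ℝ) (v : E) (u : L2 E) :
    diffSq (t • v) u = ∫⁻ ξ, ENNReal.ofReal (2 - 2 * Real.cos (t * (2 * Real.pi * inner ℝ v ξ)))
      * ‖(𝓕 u) ξ‖ₑ ^ 2 := by
  rw [diffSq_eq_lintegral_fourier]
  refine lintegral_congr fun ξ => ?_
  rw [real_inner_smul_left, show 2 * Real.pi * (t * inner ℝ v ξ)
    = t * (2 * Real.pi * inner ℝ v ξ) by ring]

/-- For `0 < s < 1` the directional form is a weighted average of squared increments. -/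
lemma incrementConst_mul_dirForm {s : ℝ} (hs : 0 < s) (v : E) (u : L2 E) :
    incrementConst s * dirForm s v u
      = ∫⁻ t in Set.Ioi (0 : ℝ), ENNReal.ofReal (t ^ (-1 - 2 * s)) * diffSq (t • v) u := by
  calc incrementConst s * dirForm s v u
      = ∫⁻ ξ : E, ∫⁻ t in Set.Ioi (0 : ℝ), ENNReal.ofReal (t ^ (-1 - 2 * s))
          * (ENNReal.ofReal (2 - 2 * Real.cos (t * (2 * Real.pi * inner ℝ v ξ)))
            * ‖(𝓕 u) ξ‖ₑ ^ 2) := by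
        rw [dirForm, ← lintegral_const_mul _ (by fun_prop)]
        refine lintegral_congr fun ξ => ?_
        rw [← mul_assoc, ← lintegral_increment_symbol hs, ← lintegral_mul_const _ (by fun_prop)]
        exact lintegral_congr fun t => mul_assoc _ _ _
    _ = ∫⁻ t in Set.Ioi (0 : ℝ), ∫⁻ ξ : E, ENNReal.ofReal (t ^ (-1 - 2 * s))
          * (ENNReal.ofReal (2 - 2 * Real.cos (t * (2 * Real.pi * inner ℝ v ξ)))
            * ‖(𝓕 u) ξ‖ₑ ^ 2) := by
        refine lintegral_lintegral_swap (Measurable.aemeasurable ?_)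
        fun_prop
    _ = _ := by
        refine lintegral_congr fun t => ?_
        rw [diffSq_smul_eq_lintegral_fourier, lintegral_const_mul _ (by fun_prop)]

lemma measurable_diffSq_smul (v : E) (u : L2 E) : Measurable fun t : ℝ => diffSq (t • v) u := by
  simp_rw [diffSq_smul_eq_lintegral_fourier]
  refine Measurable.lintegral_prod_right' (ν := (volume : Measure E)) (f := fun p : ℝ × E =>
    ENNReal.ofReal (2 - 2 * Real.cos (p.1 * (2 * Real.pi * inner ℝ v p.2)))
      * ‖(𝓕 u) p.2‖ₑ ^ 2) ?_
  fun_prop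

lemma diffSq_smul_le (t : ℝ) (v : E) (u : L2 E) :
    diffSq (t • v) u ≤ ENNReal.ofReal (t ^ 2) * dirForm 1 v u := by
  rw [diffSq_smul_eq_lintegral_fourier, dirForm, ← lintegral_const_mul _ (by fun_prop)]
  refine lintegral_mono fun ξ => ?_
  rw [← mul_assoc (ENNReal.ofReal (t ^ 2)), ← ENNReal.ofReal_mul (sq_nonneg t)]
  gcongr
  refine (two_sub_two_cos_le_sq _).trans (le_of_eq ?_)
  rw [mul_one, Real.rpow_two, sq_abs, mul_pow]

lemma tendsto_increment_symbol (a : ℝ) :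
    Filter.Tendsto (fun t : ℝ => (t ^ 2)⁻¹ * (2 - 2 * Real.cos (t * a)))
      (nhdsWithin 0 {0}ᶜ) (nhds (a ^ 2)) := by
  have h : HasDerivAt (fun t : ℝ => Real.sin (t * (a / 2))) (a / 2) 0 := by
    have := ((hasDerivAt_id (0 : ℝ)).mul_const (a / 2)).sin
    simpa using this
  have h2 := (h.tendsto_slope_zero.pow 2).const_mul 4
  have e : 4 * (a / 2) ^ 2 = a ^ 2 := by ring
  rw [e] at h2
  refine h2.congr fun t => ?_
  have hc : Real.cos (t * a) = 1 - 2 * Real.sin (t * (a / 2)) ^ 2 := by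
    rw [show t * a = 2 * (t * (a / 2)) by ring, Real.cos_two_mul, Real.cos_sq']
    ring
  simp only [zero_add, zero_mul, Real.sin_zero, sub_zero, smul_eq_mul, hc]
  rw [mul_pow, inv_pow]
  ring

/-- For `s = 1` the form is recovered from increments by Fatou's lemma. -/
lemma dirForm_one_le_liminf (v : E) (u : L2 E) :
    dirForm 1 v u ≤ Filter.liminf (fun n : ℕ =>
      ENNReal.ofReal (((1 / ((n : ℝ) + 1)) ^ 2)⁻¹) * diffSq ((1 / ((n : ℝ) + 1)) • v) u)
      Filter.atTop := by
  have ht : Filter.Tendsto (fun n : ℕ => 1 / ((n : ℝ) + 1)) Filter.atTop (nhdsWithin 0 {0}ᶜ) :=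
    tendsto_nhdsWithin_iff.2 ⟨tendsto_one_div_add_atTop_nhds_zero_nat,
      .of_forall fun n => (by positivity : (1 : ℝ) / ((n : ℝ) + 1) ≠ 0)⟩
  have h1 : ∀ n : ℕ, ENNReal.ofReal (((1 / ((n : ℝ) + 1)) ^ 2)⁻¹)
        * diffSq ((1 / ((n : ℝ) + 1)) • v) u
      = ∫⁻ ξ, ENNReal.ofReal (((1 / ((n : ℝ) + 1)) ^ 2)⁻¹
          * (2 - 2 * Real.cos (1 / ((n : ℝ) + 1) * (2 * Real.pi * inner ℝ v ξ))))
          * ‖(𝓕 u) ξ‖ₑ ^ 2 := by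
    intro n
    rw [diffSq_smul_eq_lintegral_fourier, ← lintegral_const_mul _ (by fun_prop)]
    refine lintegral_congr fun ξ => ?_
    rw [← mul_assoc, ← ENNReal.ofReal_mul (by positivity)]
  simp_rw [h1]
  refine le_trans (le_of_eq ?_) (lintegral_liminf_le fun n => by fun_prop)
  refine lintegral_congr_ae ?_
  have hfin : ∀ᵐ ξ : E, ‖(𝓕 u) ξ‖ₑ ^ 2 ≠ ∞ := .of_forall fun ξ => by simp
  filter_upwards [hfin] with ξ hξ
  symm
  refine Filter.Tendsto.liminf_eq ?_
  refine ENNReal.Tendsto.mul_const ?_ (Or.inr hξ)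
  have := (ENNReal.tendsto_ofReal ((tendsto_increment_symbol (2 * Real.pi * inner ℝ v ξ)).comp ht))
  rw [mul_one, Real.rpow_two, sq_abs]
  exact this

/-- If all increments of `u` along `v` are dominated by increments of the `w i` along `v' i`, then
so are the directional forms. For `s < 1` this is an integration over the step `t`; for `s = 1` it
is the limit `t → 0`. Through this comparison the kinetic energies of tensor powers and of roots of
densities are estimated in position space alone. -/
theorem dirForm_le_sum_of_diffSq_le {ι : Type*} [Fintype ι] {s : ℝ} (hs : 0 < s) (hs1 : s ≤ 1)
    (v : E) (u : L2 E) (v' : ι → E') (w : ι → L2 E')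
    (h : ∀ t : ℝ, diffSq (t • v) u ≤ ∑ i, diffSq (t • v' i) (w i)) :
    dirForm s v u ≤ ∑ i, dirForm s (v' i) (w i) := by
  rcases hs1.lt_or_eq with hs1 | rfl
  · rw [← ENNReal.mul_le_mul_iff_right (incrementConst_ne_zero s) (incrementConst_ne_top hs hs1),
      incrementConst_mul_dirForm hs, Finset.mul_sum]
    simp_rw [incrementConst_mul_dirForm hs]
    rw [← lintegral_finsetSum' _ fun i _ => by
      have := measurable_diffSq_smul (v' i) (w i); fun_prop]
    refine lintegral_mono fun t => ?_
    rw [← Finset.mul_sum]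
    gcongr
    exact h t
  · refine (dirForm_one_le_liminf v u).trans ?_
    refine (Filter.liminf_le_liminf (v := fun _ => ∑ i, dirForm 1 (v' i) (w i))
      (.of_forall fun n => ?_)).trans_eq (Filter.liminf_const _)
    set t : ℝ := 1 / ((n : ℝ) + 1)
    calc ENNReal.ofReal ((t ^ 2)⁻¹) * diffSq (t • v) u
        ≤ ENNReal.ofReal ((t ^ 2)⁻¹) * ∑ i, ENNReal.ofReal (t ^ 2) * dirForm 1 (v' i) (w i) := by
          gcongr
          exact (h t).trans (Finset.sum_le_sum fun i _ => diffSq_smul_le t _ _)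
      _ = _ := by
          rw [← Finset.mul_sum, ← mul_assoc, ← ENNReal.ofReal_mul (by positivity),
            inv_mul_cancel₀ (by positivity), ENNReal.ofReal_one, one_mul]

end Comparison

/-! ### Configurations, marginals and coordinate directions -/

section Configurations

variable {N d : ℕ}

lemma particle_assemble (i : Fin N) (y : Fin N → Space d) : particle i (assemble y) = y i := rfl

lemma measurable_particle (i : Fin N) : Measurable (particle i : Config N d → Space d) := by
  unfold particle
  fun_prop

/-- Grouping the coordinates of `ℝ^{dN}` by particles preserves Lebesgue measure. -/
lemma measurePreserving_assemble :
    MeasurePreserving (assemble : (Fin N → Space d) → Config N d) := by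
  have h1 : MeasurePreserving (fun (y : Fin N → Space d) i => WithLp.ofLp (y i)) :=
    volume_preserving_pi fun _ => PiLp.volume_preserving_ofLp (Fin d)
  have h2 : MeasurePreserving
      (fun (z : Fin N → Fin d → ℝ) (ik : Fin N × Fin d) => z ik.1 ik.2) := by
    refine ⟨by fun_prop, ?_⟩
    symm
    refine Measure.pi_eq fun s hs => ?_
    rw [Measure.map_apply (by fun_prop) (MeasurableSet.univ_pi hs)]
    have : (fun (z : Fin N → Fin d → ℝ) (ik : Fin N × Fin d) => z ik.1 ik.2) ⁻¹' Set.univ.pi s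
        = Set.univ.pi fun i => Set.univ.pi fun k => s (i, k) := by
      ext z
      simp
    rw [this, volume_pi_pi]
    simp_rw [volume_pi_pi]
    rw [Fintype.prod_prod_type]
  exact (PiLp.volume_preserving_toLp (Fin N × Fin d)).comp (h2.comp h1)

lemma measurable_assemble : Measurable (assemble : (Fin N → Space d) → Config N d) :=
  measurePreserving_assemble.measurable

lemma lintegral_assemble {F : Config N d → ℝ≥0∞} (hF : Measurable F) :
    ∫⁻ y : Fin N → Space d, F (assemble y) = ∫⁻ x, F x :=
  measurePreserving_assemble.lintegral_comp hF

lemma assemble_add_single (y : Fin N → Space d) (i : Fin N) (k : Fin d) (t : ℝ) :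
    assemble y + t • EuclideanSpace.single (i, k) 1
      = assemble (Function.update y i (y i + t • EuclideanSpace.single k 1)) := by
  ext ⟨j, l⟩
  by_cases hj : j = i
  · subst hj
    by_cases hl : l = k <;> simp [assemble, hl]
  · simp [assemble, hj]

/-- Tonelli: integrating out all particles but one, and then that one. -/
lemma lintegral_lmarginal_compl (i : Fin N) {F : (Fin N → Space d) → ℝ≥0∞} (hF : Measurable F)
    {g : Space d → ℝ≥0∞} (hg : Measurable g) :
    ∫⁻ x, g x * lmarginal (fun _ : Fin N => (volume : Measure (Space d))) {i}ᶜ F (fun _ => x)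
      = ∫⁻ y, g (y i) * F y := by
  have hG : Measurable fun y : Fin N → Space d => g (y i) * F y :=
    (hg.comp (measurable_pi_apply i)).mul hF
  have hpull : ∀ x, lmarginal (fun _ : Fin N => (volume : Measure (Space d))) {i}ᶜ
      (fun y => g (y i) * F y) (fun _ => x)
      = g x * lmarginal (fun _ : Fin N => (volume : Measure (Space d))) {i}ᶜ F (fun _ => x) := by
    intro x
    simp only [lmarginal]
    have hm : Measurable fun z : (({i}ᶜ : Finset (Fin N)) → Space d) =>
        F (Function.updateFinset (fun _ => x) {i}ᶜ z) := hF.comp measurable_updateFinset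
    rw [← lintegral_const_mul _ hm]
    refine lintegral_congr fun z => ?_
    simp [Function.updateFinset]
  rw [volume_pi, lintegral_eq_lmarginal_univ (fun _ => 0), ← Finset.union_compl {i},
    lmarginal_union _ _ hG disjoint_compl_right, lmarginal_singleton]
  refine lintegral_congr fun x => ?_
  rw [← hpull]
  refine lmarginal_congr _ _ fun j hj => ?_
  simp only [Finset.mem_compl, Finset.mem_singleton, not_not] at hj
  subst hj
  simp

lemma measurable_enorm_sq_assemble (Ψ : L2 (Config N d)) :
    Measurable fun y : Fin N → Space d => ‖Ψ (assemble y)‖ₑ ^ 2 :=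
  (measurable_enorm_sq_L2 Ψ).comp measurable_assemble

lemma measurable_const_lmarginal (s : Finset (Fin N)) {F : (Fin N → Space d) → ℝ≥0∞}
    (hF : Measurable F) :
    Measurable fun x : Space d => lmarginal (fun _ : Fin N => (volume : Measure (Space d))) s F
      (fun _ => x) :=
  (hF.lmarginal _).comp (by fun_prop)

lemma measurable_density (Ψ : L2 (Config N d)) : Measurable (density Ψ) :=
  Finset.measurable_sum _ fun _ _ =>
    measurable_const_lmarginal _ (measurable_enorm_sq_assemble Ψ)

/-- The density is the sum of the one-particle marginals of `|Ψ|²`. -/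
lemma lintegral_mul_density (Ψ : L2 (Config N d)) {g : Space d → ℝ≥0∞} (hg : Measurable g) :
    ∫⁻ x, g x * density Ψ x = ∑ i, ∫⁻ y : Fin N → Space d, g (y i) * ‖Ψ (assemble y)‖ₑ ^ 2 := by
  have hF := measurable_enorm_sq_assemble Ψ
  simp only [density, Finset.mul_sum]
  rw [lintegral_finsetSum]
  · exact Finset.sum_congr rfl fun i _ => lintegral_lmarginal_compl i hF hg
  · exact fun i _ => hg.mul (measurable_const_lmarginal _ hF)

lemma lintegral_enorm_sq_assemble (Ψ : L2 (Config N d)) :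
    ∫⁻ y : Fin N → Space d, ‖Ψ (assemble y)‖ₑ ^ 2 = ‖Ψ‖ₑ ^ 2 := by
  rw [enorm_sq_eq_lintegral, lintegral_assemble (measurable_enorm_sq_L2 Ψ)]

lemma lintegral_density {Ψ : L2 (Config N d)} (hΨ : ‖Ψ‖ = 1) : ∫⁻ x, density Ψ x = N := by
  have := lintegral_mul_density Ψ (g := fun _ => 1) measurable_const
  simp only [one_mul, lintegral_enorm_sq_assemble] at this
  rw [this, ← ofReal_norm, hΨ]
  simp

lemma diffSq_single {Ψ : Config N d → ℂ} (hm : Measurable Ψ) (i : Fin N) (k : Fin d) (t : ℝ) :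
    diffSq (t • EuclideanSpace.single (i, k) 1) Ψ
      = ∫⁻ y : Fin N → Space d,
        ‖Ψ (assemble (Function.update y i (y i + t • EuclideanSpace.single k 1)))
          - Ψ (assemble y)‖ₑ ^ 2 := by
  rw [diffSq, ← lintegral_assemble (by fun_prop)]
  simp_rw [assemble_add_single]

lemma diffSq_congr_ae {E : Type*} [NormedAddCommGroup E] [InnerProductSpace ℝ E]
    [FiniteDimensional ℝ E] [MeasurableSpace E] [BorelSpace E] {f g : E → ℂ}
    (hfg : f =ᵐ[volume] g) (h : E) : diffSq h f = diffSq h g := by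
  have h1 := (measurePreserving_add_right (volume : Measure E) h).quasiMeasurePreserving.ae hfg
  refine lintegral_congr_ae ?_
  filter_upwards [hfg, h1] with x h1 h2
  rw [h1, h2]

end Configurations

section Symbols

variable {ι : Type*} [Fintype ι]

/-- `‖x‖^{2s} ≤ ∑ |x_k|^{2s}` for `s ≤ 1`, by subadditivity of `t ↦ t^s`. -/
lemma norm_rpow_le_sum {s : ℝ} (hs : 0 < s) (hs1 : s ≤ 1) {c : ℝ} (hc : 0 ≤ c)
    (x : EuclideanSpace ℝ ι) :
    ENNReal.ofReal ((c * ‖x‖) ^ (2 * s)) ≤ ∑ k, ENNReal.ofReal (|c * x k| ^ (2 * s)) := by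
  have hsub : ∀ (S : Finset ι) (f : ι → ℝ≥0∞), (∑ k ∈ S, f k) ^ s ≤ ∑ k ∈ S, f k ^ s := by
    classical
    intro S f
    induction S using Finset.induction_on with
    | empty => simp [hs]
    | insert a S ha ih =>
      rw [Finset.sum_insert ha, Finset.sum_insert ha]
      exact (ENNReal.rpow_add_le_add_rpow _ _ hs.le hs1).trans (by gcongr)
  have h1 : ENNReal.ofReal ((c * ‖x‖) ^ (2 * s)) = (∑ k, ENNReal.ofReal (|c * x k| ^ 2)) ^ s := by
    rw [← ENNReal.ofReal_sum_of_nonneg (fun _ _ => by positivity),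
      ENNReal.ofReal_rpow_of_nonneg (by positivity) hs.le, Real.rpow_mul (by positivity),
      Real.rpow_two, mul_pow, EuclideanSpace.norm_sq_eq, Finset.mul_sum]
    simp [mul_pow, abs_mul]
  rw [h1]
  refine (hsub _ _).trans (le_of_eq (Finset.sum_congr rfl fun k _ => ?_))
  rw [ENNReal.ofReal_rpow_of_nonneg (by positivity) hs.le, Real.rpow_mul (abs_nonneg _),
    Real.rpow_two]

lemma inner_single_one [DecidableEq ι] (k : ι) (ξ : EuclideanSpace ℝ ι) :
    inner ℝ (EuclideanSpace.single k (1 : ℝ)) ξ = ξ k := by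
  simp [EuclideanSpace.inner_single_left]

lemma fracForm_le_sum_dirForm [DecidableEq ι] {s : ℝ} (hs : 0 < s) (hs1 : s ≤ 1)
    (u : L2 (EuclideanSpace ℝ ι)) :
    fracForm s u ≤ ∑ k, dirForm s (EuclideanSpace.single k 1) u := by
  simp only [fracForm, dirForm, inner_single_one]
  rw [← lintegral_finsetSum _ fun k _ => by fun_prop]
  refine lintegral_mono fun ξ => ?_
  rw [← Finset.sum_mul]
  gcongr
  exact norm_rpow_le_sum hs hs1 (by positivity) ξ

lemma dirForm_single_le_fracForm [DecidableEq ι] {s : ℝ} (hs : 0 < s) (k : ι)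
    (u : L2 (EuclideanSpace ℝ ι)) :
    dirForm s (EuclideanSpace.single k 1) u ≤ fracForm s u := by
  simp only [fracForm, dirForm, inner_single_one]
  refine lintegral_mono fun ξ => ?_
  gcongr
  rw [abs_mul, abs_of_pos Real.two_pi_pos]
  gcongr
  exact PiLp.norm_apply_le ξ k

variable {N d : ℕ}

lemma kineticEnergy_le_sum_dirForm {s : ℝ} (hs : 0 < s) (hs1 : s ≤ 1) (Ψ : L2 (Config N d)) :
    kineticEnergy s Ψ
      ≤ ∑ i : Fin N, ∑ k : Fin d, dirForm s (EuclideanSpace.single (i, k) 1) Ψ := by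
  simp only [kineticEnergy, dirForm, inner_single_one]
  refine Finset.sum_le_sum fun i _ => ?_
  rw [← lintegral_finsetSum _ fun k _ => by fun_prop]
  refine lintegral_mono fun ξ => ?_
  rw [← Finset.sum_mul]
  gcongr
  exact norm_rpow_le_sum hs hs1 (by positivity) (particle i ξ)

lemma sum_dirForm_le_kineticEnergy {s : ℝ} (hs : 0 < s) (k : Fin d) (Ψ : L2 (Config N d)) :
    ∑ i : Fin N, dirForm s (EuclideanSpace.single (i, k) 1) Ψ ≤ kineticEnergy s Ψ := by
  simp only [kineticEnergy, dirForm, inner_single_one]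
  refine Finset.sum_le_sum fun i _ => lintegral_mono fun ξ => ?_
  gcongr
  rw [abs_mul, abs_of_pos Real.two_pi_pos]
  gcongr
  exact PiLp.norm_apply_le (particle i ξ) k

end Symbols

/-! ### Tensor powers -/

section TensorPower

variable {N d : ℕ}

lemma lintegral_fin_prod {X : Type*} [MeasureSpace X] [SigmaFinite (volume : Measure X)] (N : ℕ)
    (f : Fin N → X → ℝ≥0∞) (hf : ∀ i, Measurable (f i)) :
    ∫⁻ y : Fin N → X, ∏ i, f i (y i) = ∏ i, ∫⁻ x, f i x := by
  induction N with
  | zero => simp [volume_pi]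
  | succ n ih =>
    have hm := (volume_preserving_piFinSuccAbove (fun _ : Fin (n + 1) => X) 0).symm
    rw [← hm.lintegral_comp (by fun_prop)]
    simp only [Fin.prod_univ_succ, MeasurableEquiv.piFinSuccAbove_symm_apply,
      Fin.insertNthEquiv_zero, Fin.consEquiv_apply, Fin.cons_zero, Fin.cons_succ]
    rw [Measure.volume_eq_prod, lintegral_prod_mul (f := f 0)
        (g := fun y : Fin n → X => ∏ i, f i.succ (y i)) (hf 0).aemeasurable
        (Finset.measurable_prod _ fun i _ =>
          (hf i.succ).comp (measurable_pi_apply i)).aemeasurable,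
      ih _ fun i => hf i.succ]

/-- The function `w ⊗ ⋯ ⊗ w` on configuration space. -/
def tensorFun (N : ℕ) (w : L2 (Space d)) (x : Config N d) : ℂ := ∏ i, w (particle i x)

lemma measurable_tensorFun (w : L2 (Space d)) : Measurable (tensorFun N w) := by
  have hm : Measurable w := (Lp.stronglyMeasurable w).measurable
  exact Finset.measurable_prod _ fun i _ => hm.comp (measurable_particle i)

lemma enorm_tensorFun_assemble (w : L2 (Space d)) (y : Fin N → Space d) :
    ‖tensorFun N w (assemble y)‖ₑ ^ 2 = ∏ i, ‖w (y i)‖ₑ ^ 2 := by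
  simp only [tensorFun, particle_assemble, enorm_eq_nnnorm, nnnorm_prod,
    ENNReal.ofNNReal_finsetProd, Finset.prod_pow]

lemma lintegral_enorm_sq_tensorFun (w : L2 (Space d)) :
    ∫⁻ x, ‖tensorFun N w x‖ₑ ^ 2 = (‖w‖ₑ ^ 2) ^ N := by
  rw [← lintegral_assemble ((measurable_tensorFun w).enorm.pow_const 2)]
  simp_rw [enorm_tensorFun_assemble]
  rw [lintegral_fin_prod N (fun _ x => ‖w x‖ₑ ^ 2) fun _ => measurable_enorm_sq_L2 w]
  simp [enorm_sq_eq_lintegral]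

lemma memLp_two_of_lintegral_lt_top {E : Type*} [NormedAddCommGroup E] [InnerProductSpace ℝ E]
    [FiniteDimensional ℝ E] [MeasurableSpace E] [BorelSpace E] {f : E → ℂ} (hf : Measurable f)
    (h : ∫⁻ x, ‖f x‖ₑ ^ 2 < ∞) : MemLp f 2 volume := by
  refine ⟨hf.aestronglyMeasurable, ?_⟩
  rw [eLpNorm_lt_top_iff_lintegral_rpow_enorm_lt_top (by norm_num) (by norm_num)]
  simpa using h

lemma memLp_tensorFun (w : L2 (Space d)) : MemLp (tensorFun N w) 2 volume := by
  refine memLp_two_of_lintegral_lt_top (measurable_tensorFun w) ?_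
  rw [lintegral_enorm_sq_tensorFun]
  exact ENNReal.pow_lt_top (ENNReal.pow_lt_top enorm_lt_top)

/-- The tensor power `w^{⊗N}` as an element of `L²(ℝ^{dN})`. -/
def tensorPow (N : ℕ) (w : L2 (Space d)) : L2 (Config N d) := (memLp_tensorFun w).toLp

lemma coeFn_tensorPow (w : L2 (Space d)) : tensorPow N w =ᵐ[volume] tensorFun N w :=
  (memLp_tensorFun w).coeFn_toLp

lemma enorm_sq_tensorPow_assemble (w : L2 (Space d)) :
    ∀ᵐ y : Fin N → Space d, ‖tensorPow N w (assemble y)‖ₑ ^ 2 = ∏ i, ‖w (y i)‖ₑ ^ 2 := by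
  filter_upwards [measurePreserving_assemble.quasiMeasurePreserving.ae (coeFn_tensorPow w)]
    with y hy
  rw [hy, enorm_tensorFun_assemble]

lemma enorm_eq_one {E : Type*} [SeminormedAddGroup E] {x : E} (hx : ‖x‖ = 1) : ‖x‖ₑ = 1 := by
  rw [← ofReal_norm, hx, ENNReal.ofReal_one]

lemma norm_tensorPow {w : L2 (Space d)} (hw : ‖w‖ = 1) : ‖tensorPow N w‖ = 1 := by
  have h : ‖tensorPow N w‖ₑ ^ 2 = 1 := by
    rw [enorm_sq_eq_lintegral, lintegral_congr_ae ((coeFn_tensorPow w).mono fun x hx => by rw [hx]),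
      lintegral_enorm_sq_tensorFun, enorm_eq_one hw]
    simp
  rw [← ofReal_norm, ← ENNReal.ofReal_pow (norm_nonneg _), ENNReal.ofReal_eq_one] at h
  exact (pow_eq_one_iff_of_nonneg (norm_nonneg _) two_ne_zero).1 h

/-- Displacing one particle of a tensor power changes only one factor. -/
lemma diffSq_tensorPow {w : L2 (Space d)} (hw : ‖w‖ = 1) (i : Fin N) (k : Fin d) (t : ℝ) :
    diffSq (t • EuclideanSpace.single (i, k) 1) (tensorPow N w)
      = diffSq (t • EuclideanSpace.single k 1) w := by
  rw [diffSq_congr_ae (coeFn_tensorPow w), diffSq_single (measurable_tensorFun w)]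
  set h : Space d := t • EuclideanSpace.single k 1
  let g : Fin N → Space d → ℝ≥0∞ :=
    Function.update (fun _ x => ‖w x‖ₑ ^ 2) i (fun x => ‖w (x + h) - w x‖ₑ ^ 2)
  have hg : ∀ j, Measurable (g j) := by
    intro j
    by_cases hj : j = i
    · subst hj
      simp only [g, Function.update_self]
      fun_prop
    · simp only [g, Function.update_of_ne hj]
      fun_prop
  have hpt : ∀ y : Fin N → Space d,
      ‖tensorFun N w (assemble (Function.update y i (y i + h))) - tensorFun N w (assemble y)‖ₑ ^ 2
        = ∏ j, g j (y j) := by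
    intro y
    simp only [tensorFun, particle_assemble]
    rw [← Finset.mul_prod_erase _ _ (Finset.mem_univ i),
      ← Finset.mul_prod_erase _ (fun j => w (y j)) (Finset.mem_univ i),
      ← Finset.mul_prod_erase _ _ (Finset.mem_univ i)]
    have e1 : ∏ j ∈ Finset.univ.erase i, w (Function.update y i (y i + h) j)
        = ∏ j ∈ Finset.univ.erase i, w (y j) :=
      Finset.prod_congr rfl fun j hj => by rw [Function.update_of_ne (Finset.ne_of_mem_erase hj)]
    have e2 : ∏ j ∈ Finset.univ.erase i, g j (y j)
        = ∏ j ∈ Finset.univ.erase i, ‖w (y j)‖ₑ ^ 2 :=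
      Finset.prod_congr rfl fun j hj => by
        simp only [g, Function.update_of_ne (Finset.ne_of_mem_erase hj)]
    rw [e1, e2, Function.update_self, ← sub_mul, enorm_mul, mul_pow]
    simp only [g, Function.update_self, enorm_eq_nnnorm, nnnorm_prod, ENNReal.ofNNReal_finsetProd,
      Finset.prod_pow]
  simp_rw [hpt]
  rw [lintegral_fin_prod N g hg, ← Finset.mul_prod_erase _ _ (Finset.mem_univ i),
    Finset.prod_eq_one fun j hj => ?_]
  · simp only [g, Function.update_self, mul_one]
    rfl
  · simp only [g, Function.update_of_ne (Finset.ne_of_mem_erase hj)]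
    rw [← enorm_sq_eq_lintegral, enorm_eq_one hw, one_pow]

lemma dirForm_tensorPow_le {s : ℝ} (hs : 0 < s) (hs1 : s ≤ 1) {w : L2 (Space d)} (hw : ‖w‖ = 1)
    (i : Fin N) (k : Fin d) :
    dirForm s (EuclideanSpace.single (i, k) 1) (tensorPow N w) ≤ fracForm s w := by
  have := dirForm_le_sum_of_diffSq_le hs hs1 (EuclideanSpace.single (i, k) 1) (tensorPow N w)
    (fun _ : Unit => EuclideanSpace.single k 1) (fun _ => w)
    fun t => by simp [diffSq_tensorPow hw]
  simp only [Finset.univ_unique, Finset.sum_const, Finset.card_singleton, one_smul] at this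
  exact this.trans (dirForm_single_le_fracForm hs k w)

lemma kineticEnergy_tensorPow_le {s : ℝ} (hs : 0 < s) (hs1 : s ≤ 1) {w : L2 (Space d)}
    (hw : ‖w‖ = 1) : kineticEnergy s (tensorPow N w) ≤ N * (d * fracForm s w) := by
  refine (kineticEnergy_le_sum_dirForm hs hs1 _).trans ?_
  refine (Finset.sum_le_sum fun i _ => Finset.sum_le_sum fun k _ =>
    dirForm_tensorPow_le hs hs1 hw i k).trans (le_of_eq ?_)
  simp

lemma memHs_tensorPow {s : ℝ} (hs : 0 < s) (hs1 : s ≤ 1) {w : L2 (Space d)} (hw : ‖w‖ = 1)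
    (h : MemHs s w) : MemHs s (tensorPow N w) := by
  refine (fracForm_le_sum_dirForm hs hs1 _).trans_lt (ENNReal.sum_lt_top.2 fun ik _ => ?_)
  exact (dirForm_tensorPow_le hs hs1 hw ik.1 ik.2).trans_lt h

/-- The probability measure `|w|² dx`. -/
def bornMeasure (w : L2 (Space d)) : Measure (Space d) := volume.withDensity fun x => ‖w x‖ₑ ^ 2

lemma isProbabilityMeasure_bornMeasure {w : L2 (Space d)} (hw : ‖w‖ = 1) :
    IsProbabilityMeasure (bornMeasure w) := by
  refine ⟨?_⟩
  rw [bornMeasure, withDensity_apply _ MeasurableSet.univ, Measure.restrict_univ,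
    ← enorm_sq_eq_lintegral, enorm_eq_one hw, one_pow]

lemma lintegral_bornMeasure (w : L2 (Space d)) {g : Space d → ℝ≥0∞} (hg : Measurable g) :
    ∫⁻ x, g x ∂bornMeasure w = ∫⁻ x, ‖w x‖ₑ ^ 2 * g x :=
  lintegral_withDensity_eq_lintegral_mul _ (measurable_enorm_sq_L2 w) hg

lemma pi_bornMeasure {w : L2 (Space d)} (hw : ‖w‖ = 1) :
    Measure.pi (fun _ : Fin N => bornMeasure w)
      = (volume : Measure (Fin N → Space d)).withDensity fun y => ∏ i, ‖w (y i)‖ₑ ^ 2 := by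
  have := isProbabilityMeasure_bornMeasure hw
  have hm := measurable_enorm_sq_L2 w
  refine Measure.pi_eq fun A hA => ?_
  rw [withDensity_apply _ (MeasurableSet.univ_pi hA),
    ← lintegral_indicator (MeasurableSet.univ_pi hA)]
  have : ∀ y : Fin N → Space d,
      (Set.univ.pi A).indicator (fun y => ∏ i, ‖w (y i)‖ₑ ^ 2) y
        = ∏ i, (A i).indicator (fun x => ‖w x‖ₑ ^ 2) (y i) := by
    intro y
    by_cases hy : y ∈ Set.univ.pi A
    · rw [Set.indicator_of_mem hy]
      exact Finset.prod_congr rfl fun i _ => by rw [Set.indicator_of_mem (hy i trivial)]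
    · rw [Set.indicator_of_notMem hy]
      simp only [Set.mem_pi, Set.mem_univ, true_implies, not_forall] at hy
      obtain ⟨i, hi⟩ := hy
      exact (Finset.prod_eq_zero (Finset.mem_univ i) (Set.indicator_of_notMem hi _)).symm
  simp_rw [this]
  rw [lintegral_fin_prod N (fun i => (A i).indicator fun x => ‖w x‖ₑ ^ 2)
    fun i => hm.indicator (hA i)]
  refine Finset.prod_congr rfl fun i _ => ?_
  rw [lintegral_indicator (hA i), bornMeasure, withDensity_apply _ (hA i)]

/-- Under `|w^{⊗N}|²` the particles are independent with law `bornMeasure w`. -/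
lemma lintegral_tensorPow {w : L2 (Space d)} (hw : ‖w‖ = 1) {G : (Fin N → Space d) → ℝ≥0∞}
    (hG : Measurable G) :
    ∫⁻ y : Fin N → Space d, ‖tensorPow N w (assemble y)‖ₑ ^ 2 * G y
      = ∫⁻ y, G y ∂Measure.pi (fun _ : Fin N => bornMeasure w) := by
  rw [pi_bornMeasure hw, lintegral_withDensity_eq_lintegral_mul _ (by fun_prop) hG]
  refine lintegral_congr_ae ?_
  filter_upwards [enorm_sq_tensorPow_assemble (N := N) w] with y hy
  rw [hy, Pi.mul_apply]

lemma density_tensorPow {w : L2 (Space d)} (hw : ‖w‖ = 1) :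
    density (tensorPow N w) =ᵐ[volume] fun x => N * ‖w x‖ₑ ^ 2 := by
  have := isProbabilityMeasure_bornMeasure hw
  have hm := measurable_enorm_sq_L2 w
  refine ae_eq_of_forall_setLIntegral_eq_of_sigmaFinite (measurable_density _) (by fun_prop) ?_
  intro A hA _
  have h1 : ∀ f : Space d → ℝ≥0∞, ∫⁻ x in A, f x = ∫⁻ x, A.indicator 1 x * f x := by
    intro f
    rw [← lintegral_indicator hA]
    refine lintegral_congr fun x => ?_
    by_cases hx : x ∈ A <;> simp [hx]
  have hA1 : Measurable (A.indicator (1 : Space d → ℝ≥0∞)) := measurable_one.indicator hA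
  rw [h1, h1, lintegral_mul_density _ hA1]
  have h2 : ∀ i : Fin N, ∫⁻ y : Fin N → Space d,
      A.indicator 1 (y i) * ‖tensorPow N w (assemble y)‖ₑ ^ 2
        = ∫⁻ x, A.indicator 1 x * ‖w x‖ₑ ^ 2 := by
    intro i
    simp_rw [mul_comm (A.indicator (1 : Space d → ℝ≥0∞) _)]
    rw [lintegral_tensorPow hw (G := fun y => A.indicator 1 (y i))
      (hA1.comp (measurable_pi_apply i)), ← lintegral_bornMeasure w hA1]
    exact (measurePreserving_eval (fun _ : Fin N => bornMeasure w) i).lintegral_comp hA1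
  simp_rw [h2]
  simp only [Finset.sum_const, Finset.card_univ, Fintype.card_fin, nsmul_eq_mul]
  have hA2 : Measurable fun x => A.indicator (1 : Space d → ℝ≥0∞) x * ‖w x‖ₑ ^ 2 := hA1.mul hm
  rw [← lintegral_const_mul _ hA2]
  exact lintegral_congr fun x => by ring

lemma measurable_kernel (s : ℝ) : Measurable fun p : Space d × Space d =>
    (1 : ℝ≥0∞) / ‖p.1 - p.2‖ₑ ^ (2 * s) := by
  fun_prop

/-- Two particles of a tensor power are independent, so each pair contributes the energy of `w`. -/
lemma interaction_pair_tensorPow (s : ℝ) {w : L2 (Space d)} (hw : ‖w‖ = 1) {i j : Fin N}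
    (hij : i ≠ j) :
    ∫⁻ x : Config N d, ‖tensorPow N w x‖ₑ ^ 2 / ‖particle i x - particle j x‖ₑ ^ (2 * s)
      = rieszEnergy s w := by
  have := isProbabilityMeasure_bornMeasure hw
  have hm := measurable_enorm_sq_L2 w
  have hpi := measurable_particle (d := d) i
  have hpj := measurable_particle (d := d) j
  have hk := measurable_kernel (d := d) s
  have hind : ProbabilityTheory.IndepFun (fun y : Fin N → Space d => y i) (fun y => y j)
      (Measure.pi fun _ : Fin N => bornMeasure w) :=
    (ProbabilityTheory.iIndepFun_pi (X := fun _ => id) (μ := fun _ : Fin N => bornMeasure w)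
      fun _ => aemeasurable_id).indepFun hij
  have hmap := (ProbabilityTheory.indepFun_iff_map_prod_eq_prod_map_map
    (measurable_pi_apply i).aemeasurable (measurable_pi_apply j).aemeasurable).1 hind
  have e1 := (measurePreserving_eval (fun _ : Fin N => bornMeasure w) i).map_eq
  have e2 := (measurePreserving_eval (fun _ : Fin N => bornMeasure w) j).map_eq
  rw [show (fun y : Fin N → Space d => y i) = Function.eval i from rfl,
    show (fun y : Fin N → Space d => y j) = Function.eval j from rfl, e1, e2] at hmap
  rw [← lintegral_assemble (by fun_prop)]
  simp only [particle_assemble]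
  calc ∫⁻ y : Fin N → Space d, ‖tensorPow N w (assemble y)‖ₑ ^ 2 / ‖y i - y j‖ₑ ^ (2 * s)
      = ∫⁻ y : Fin N → Space d, ‖tensorPow N w (assemble y)‖ₑ ^ 2
          * (1 / ‖y i - y j‖ₑ ^ (2 * s)) := by
        refine lintegral_congr fun y => ?_
        rw [mul_one_div]
    _ = ∫⁻ p, 1 / ‖p.1 - p.2‖ₑ ^ (2 * s) ∂(bornMeasure w).prod (bornMeasure w) := by
        rw [lintegral_tensorPow hw (by fun_prop), ← hmap, lintegral_map hk (by fun_prop)]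
    _ = ∫⁻ x, ∫⁻ y, 1 / ‖x - y‖ₑ ^ (2 * s) ∂bornMeasure w ∂bornMeasure w :=
        lintegral_prod _ hk.aemeasurable
    _ = rieszEnergy s w := by
        rw [lintegral_bornMeasure w hk.lintegral_prod_right']
        refine lintegral_congr fun x => ?_
        have hkx : Measurable fun y : Space d => (1 : ℝ≥0∞) / ‖x - y‖ₑ ^ (2 * s) := by fun_prop
        have hmk : Measurable fun y : Space d => ‖w y‖ₑ ^ 2 * (1 / ‖x - y‖ₑ ^ (2 * s)) := hm.mul hkx
        rw [lintegral_bornMeasure w hkx, ← lintegral_const_mul _ hmk]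
        refine lintegral_congr fun y => ?_
        rw [← mul_assoc, mul_one_div]

lemma interactionEnergy_tensorPow_le (s : ℝ) {w : L2 (Space d)} (hw : ‖w‖ = 1) :
    interactionEnergy s (tensorPow N w) ≤ N * ((N - 1 : ℕ) * rieszEnergy s w) := by
  have : ∀ i : Fin N, ∑ j ∈ Finset.Ioi i, ∫⁻ x : Config N d,
      ‖tensorPow N w x‖ₑ ^ 2 / ‖particle i x - particle j x‖ₑ ^ (2 * s)
        ≤ (N - 1 : ℕ) * rieszEnergy s w := by
    intro i
    rw [Finset.sum_congr rfl fun j hj =>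
      interaction_pair_tensorPow s hw (Finset.mem_Ioi.1 hj).ne, Finset.sum_const, nsmul_eq_mul,
      Fin.card_Ioi]
    gcongr ?_ * _
    exact Nat.cast_le.2 (by omega)
  refine (Finset.sum_le_sum fun i _ => this i).trans (le_of_eq ?_)
  simp

end TensorPower

/-! ### From the many-body to the one-body inequality -/

section OneBody

variable {d : ℕ}

/-- The optimisation over the particle number: `N ≈ k / D` if `k > D`, and `N = 1` otherwise. -/
lemma le_rpow_mul_rpow_of_forall_nat {θ C k D i a : ℝ} (hθ : 0 < θ) (hC : 0 < C)
    (hk : 0 ≤ k) (hD : 0 ≤ D) (hi : 0 ≤ i) (ha : 0 ≤ a)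
    (h : ∀ N : ℕ, 1 ≤ N → C * (N : ℝ) ^ θ * i ≤ a * k + ((N : ℝ) - 1) * D) :
    C * i ≤ (a + 1) * (k ^ (1 - θ) * D ^ θ) := by
  have hsplit : ∀ {x : ℝ}, 0 < x → x ^ (1 - θ) * x ^ θ = x := fun {x} hx => by
    rw [← Real.rpow_add hx, sub_add_cancel, Real.rpow_one]
  have h1 : C * i ≤ a * k := by simpa using h 1 le_rfl
  rcases hk.eq_or_lt with rfl | hk0
  · rw [mul_zero] at h1
    exact h1.trans (by positivity)
  rcases le_or_gt k D with hkD | hkD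
  · calc C * i ≤ a * (k ^ (1 - θ) * k ^ θ) := by rwa [hsplit hk0]
      _ ≤ (a + 1) * (k ^ (1 - θ) * D ^ θ) := by
        gcongr
        linarith
  rcases hD.eq_or_lt with rfl | hD0
  · have hi0 : i = 0 := by
      by_contra hne
      have hpos : 0 < C * i := mul_pos hC (lt_of_le_of_ne hi (Ne.symm hne))
      have ht : Filter.Tendsto (fun N : ℕ => (N : ℝ) ^ θ) Filter.atTop Filter.atTop :=
        (tendsto_rpow_atTop hθ).comp tendsto_natCast_atTop_atTop
      obtain ⟨N, hN, hN1⟩ := ((ht.eventually_gt_atTop (a * k / (C * i))).and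
        (Filter.eventually_ge_atTop 1)).exists
      have := h N hN1
      rw [div_lt_iff₀ hpos] at hN
      nlinarith
    rw [hi0, mul_zero]
    positivity
  · set N := ⌈k / D⌉₊ with hN
    have hN0 : 0 < k / D := by positivity
    have hN1 : 1 ≤ N := Nat.one_le_iff_ne_zero.2 (Nat.ceil_pos.2 hN0).ne'
    have hle : k / D ≤ N := Nat.le_ceil _
    have hlt : (N : ℝ) < k / D + 1 := Nat.ceil_lt_add_one hN0.le
    have h2 : C * (k / D) ^ θ * i ≤ (a + 1) * k := by
      calc C * (k / D) ^ θ * i ≤ C * (N : ℝ) ^ θ * i := by gcongr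
        _ ≤ a * k + ((N : ℝ) - 1) * D := h N hN1
        _ ≤ a * k + (k / D) * D := by gcongr; linarith
        _ = (a + 1) * k := by rw [div_mul_cancel₀ _ hD0.ne']; ring
    rw [Real.div_rpow hk hD] at h2
    have hkθ : 0 < k ^ θ := Real.rpow_pos_of_pos hk0 _
    refine le_of_mul_le_mul_right ?_ hkθ
    calc C * i * k ^ θ = (C * (k ^ θ / D ^ θ) * i) * D ^ θ := by field_simp
      _ ≤ (a + 1) * k * D ^ θ := by gcongr
      _ = (a + 1) * (k ^ (1 - θ) * k ^ θ) * D ^ θ := by rw [hsplit hk0]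
      _ = _ := by ring

/-- The extended-real form of `le_rpow_mul_rpow_of_forall_nat`. -/
lemma ennreal_le_rpow_mul_rpow_of_forall_nat {θ C : ℝ} (hθ : 0 < θ) (hθ1 : θ < 1) (hC : 0 < C)
    {a : ℕ} {k D i : ℝ≥0∞} (hk : k ≠ ∞)
    (h : ∀ N : ℕ, 1 ≤ N →
      ENNReal.ofReal C * ((N : ℝ≥0∞) ^ θ * i) ≤ a * k + ((N - 1 : ℕ) : ℝ≥0∞) * D) :
    ENNReal.ofReal (C / (a + 1)) * i ≤ k ^ (1 - θ) * D ^ θ := by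
  have hCt : ENNReal.ofReal C ≠ 0 := (ENNReal.ofReal_pos.2 hC).ne'
  have h1 : ENNReal.ofReal C * i ≤ a * k := by simpa using h 1 le_rfl
  have hak : (a : ℝ≥0∞) * k ≠ ∞ := ENNReal.mul_ne_top (ENNReal.natCast_ne_top a) hk
  have hi : i ≠ ∞ := by
    rintro rfl
    rw [ENNReal.mul_top hCt] at h1
    exact hak (top_le_iff.1 h1)
  rcases eq_or_ne k 0 with rfl | hk0
  · have : i = 0 := by simpa [hCt] using h1
    simp [this]
  rcases eq_or_ne D ∞ with rfl | hD
  · rw [ENNReal.top_rpow_of_pos hθ, ENNReal.mul_top]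
    · exact le_top
    · simp [hk0, hk]
  lift k to NNReal using hk
  lift D to NNReal using hD
  lift i to NNReal using hi
  have hreal : C * (i : ℝ) ≤ ((a : ℝ) + 1) * ((k : ℝ) ^ (1 - θ) * (D : ℝ) ^ θ) := by
    refine le_rpow_mul_rpow_of_forall_nat hθ hC k.coe_nonneg D.coe_nonneg i.coe_nonneg
      a.cast_nonneg fun N hN => ?_
    have h2 := h N hN
    have h3 := (ENNReal.toReal_le_toReal (ENNReal.mul_ne_top ENNReal.ofReal_ne_top
      (ENNReal.mul_ne_top (ENNReal.rpow_ne_top_of_nonneg hθ.le (ENNReal.natCast_ne_top N))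
        ENNReal.coe_ne_top))
      (ENNReal.add_ne_top.2 ⟨hak, ENNReal.mul_ne_top (ENNReal.natCast_ne_top _)
        ENNReal.coe_ne_top⟩)).2 h2
    rw [ENNReal.toReal_add hak (ENNReal.mul_ne_top (ENNReal.natCast_ne_top _)
        ENNReal.coe_ne_top)] at h3
    simp only [ENNReal.toReal_mul, ENNReal.toReal_ofReal hC.le, ← ENNReal.toReal_rpow,
      ENNReal.toReal_natCast, ENNReal.coe_toReal] at h3
    rw [Nat.cast_sub hN, Nat.cast_one] at h3
    linarith
  rw [ENNReal.ofReal_div_of_pos (by positivity), mul_comm, ← mul_div_assoc]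
  refine ENNReal.div_le_of_le_mul ?_
  have e1 : (k : ℝ≥0∞) ^ (1 - θ) * (D : ℝ≥0∞) ^ θ
      = ENNReal.ofReal ((k : ℝ) ^ (1 - θ) * (D : ℝ) ^ θ) := by
    rw [ENNReal.ofReal_mul (by positivity),
      ← ENNReal.ofReal_rpow_of_nonneg k.coe_nonneg (by linarith),
      ← ENNReal.ofReal_rpow_of_nonneg D.coe_nonneg hθ.le, ENNReal.ofReal_coe_nnreal,
      ENNReal.ofReal_coe_nnreal]
  rw [e1, ← ENNReal.ofReal_coe_nnreal, ← ENNReal.ofReal_mul i.coe_nonneg,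
    ← ENNReal.ofReal_mul (by positivity)]
  refine ENNReal.ofReal_le_ofReal ?_
  linarith

lemma enorm_coeFn_smul {E : Type*} [NormedAddCommGroup E] [InnerProductSpace ℝ E]
    [FiniteDimensional ℝ E] [MeasurableSpace E] [BorelSpace E] (c : ℂ) (w : L2 E) :
    ∀ᵐ x, ‖(c • w) x‖ₑ = ‖c‖ₑ * ‖w x‖ₑ := by
  filter_upwards [Lp.coeFn_smul c w] with x hx
  rw [hx, Pi.smul_apply, enorm_smul]

lemma fracForm_smul (s : ℝ) (c : ℂ) (w : L2 (Space d)) :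
    fracForm s (c • w) = ‖c‖ₑ ^ 2 * fracForm s w := by
  have h : 𝓕 (c • w) = c • 𝓕 w := (Lp.fourierTransformₗᵢ (Space d) ℂ).map_smul c w
  rw [fracForm, fracForm, ← lintegral_const_mul _ (by fun_prop), h]
  refine lintegral_congr_ae ?_
  filter_upwards [enorm_coeFn_smul c (𝓕 w)] with ξ hξ
  rw [hξ]
  ring

lemma rieszEnergy_smul (s : ℝ) (c : ℂ) (w : L2 (Space d)) :
    rieszEnergy s (c • w) = ‖c‖ₑ ^ 4 * rieszEnergy s w := by
  have hc : ‖c‖ₑ ^ 4 ≠ ∞ := by simp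
  rw [rieszEnergy, rieszEnergy, ← lintegral_const_mul' _ _ hc]
  refine lintegral_congr_ae ?_
  filter_upwards [enorm_coeFn_smul c w] with x hx
  rw [← lintegral_const_mul' _ _ hc]
  refine lintegral_congr_ae ?_
  filter_upwards [enorm_coeFn_smul c w] with y hy
  rw [hx, hy, ← mul_div_assoc]
  congr 1
  ring

lemma lintegral_enorm_rpow_smul {p : ℝ} (hp : 0 ≤ p) (c : ℂ) (w : L2 (Space d)) :
    ∫⁻ x, ‖(c • w) x‖ₑ ^ p = ‖c‖ₑ ^ p * ∫⁻ x, ‖w x‖ₑ ^ p := by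
  rw [← lintegral_const_mul' _ _ (ENNReal.rpow_ne_top_of_nonneg hp enorm_ne_top)]
  refine lintegral_congr_ae ?_
  filter_upwards [enorm_coeFn_smul c w] with x hx
  rw [hx, ENNReal.mul_rpow_of_nonneg _ _ hp]

/-- Testing the many-body inequality on tensor powers of a normalised `w`. -/
lemma interpolation_of_liebThirring_of_norm_eq_one {s : ℝ} (hs : 0 < s) (hsd : s < (d : ℝ) / 2)
    (hs1 : s ≤ 1) {C : ℝ} (hC : 0 < C)
    (h : ∀ N : ℕ, 1 ≤ N → ∀ Ψ : L2 (Config N d), ‖Ψ‖ = 1 → MemHs s Ψ →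
      ENNReal.ofReal C * ∫⁻ x, density Ψ x ^ (1 + 2 * s / (d : ℝ))
        ≤ kineticEnergy s Ψ + interactionEnergy s Ψ)
    {w : L2 (Space d)} (hw : ‖w‖ = 1) (hwH : MemHs s w) :
    ENNReal.ofReal (C / (d + 1)) * ∫⁻ x, ‖w x‖ₑ ^ (2 * (1 + 2 * s / (d : ℝ)))
      ≤ fracForm s w ^ (1 - 2 * s / (d : ℝ)) * rieszEnergy s w ^ (2 * s / (d : ℝ)) := by
  have hd : 0 < (d : ℝ) := by linarith
  set θ := 2 * s / (d : ℝ) with hθ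
  have hθ0 : 0 < θ := by positivity
  have hθ1 : θ < 1 := by rw [hθ, div_lt_one hd]; linarith
  refine ennreal_le_rpow_mul_rpow_of_forall_nat hθ0 hθ1 hC hwH.ne fun N hN => ?_
  have h1 := (h N hN (tensorPow N w) (norm_tensorPow hw) (memHs_tensorPow hs hs1 hw hwH)).trans
    (add_le_add (kineticEnergy_tensorPow_le hs hs1 hw) (interactionEnergy_tensorPow_le s hw))
  have hN0 : (N : ℝ≥0∞) ≠ 0 := by exact_mod_cast (by omega : N ≠ 0)
  have hNt : (N : ℝ≥0∞) ≠ ∞ := ENNReal.natCast_ne_top N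
  have h2 : ∫⁻ x, density (tensorPow N w) x ^ (1 + θ)
      = N * ((N : ℝ≥0∞) ^ θ * ∫⁻ x, ‖w x‖ₑ ^ (2 * (1 + θ))) := by
    rw [← mul_assoc]
    have hNN : (N : ℝ≥0∞) * (N : ℝ≥0∞) ^ θ = (N : ℝ≥0∞) ^ (1 + θ) := by
      rw [ENNReal.rpow_add _ _ hN0 hNt, ENNReal.rpow_one]
    rw [hNN, ← lintegral_const_mul' _ _ (ENNReal.rpow_ne_top_of_nonneg (by linarith) hNt)]
    refine lintegral_congr_ae ?_
    filter_upwards [density_tensorPow (N := N) hw] with x hx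
    rw [hx, ENNReal.mul_rpow_of_nonneg _ _ (by linarith), ENNReal.rpow_mul, ENNReal.rpow_two]
  rw [h2, ← mul_add, mul_left_comm, ENNReal.mul_le_mul_iff_right hN0 hNt] at h1
  exact h1

/-- The many-body inequality implies the one-body inequality, whose two sides scale alike under
`u ↦ c u`, so that it suffices to treat normalised functions. -/
theorem interpolation_of_liebThirring {s : ℝ} (hs : 0 < s) (hsd : s < (d : ℝ) / 2)
    (hs1 : s ≤ 1) {C : ℝ} (hC : 0 < C)
    (h : ∀ N : ℕ, 1 ≤ N → ∀ Ψ : L2 (Config N d), ‖Ψ‖ = 1 → MemHs s Ψ →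
      ENNReal.ofReal C * ∫⁻ x, density Ψ x ^ (1 + 2 * s / (d : ℝ))
        ≤ kineticEnergy s Ψ + interactionEnergy s Ψ)
    (u : L2 (Space d)) (hu : MemHs s u) :
    ENNReal.ofReal (C / (d + 1)) * ∫⁻ x, ‖u x‖ₑ ^ (2 * (1 + 2 * s / (d : ℝ)))
      ≤ fracForm s u ^ (1 - 2 * s / (d : ℝ)) * rieszEnergy s u ^ (2 * s / (d : ℝ)) := by
  have hd : 0 < (d : ℝ) := by linarith
  have hθ0 : 0 < 2 * s / (d : ℝ) := by positivity
  have hθ1 : 2 * s / (d : ℝ) < 1 := by rw [div_lt_one hd]; linarith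
  rcases eq_or_ne u 0 with rfl | hu0
  · have : ∫⁻ x, ‖(0 : L2 (Space d)) x‖ₑ ^ (2 * (1 + 2 * s / (d : ℝ))) = 0 := by
      rw [← lintegral_zero (μ := (volume : Measure (Space d)))]
      refine lintegral_congr_ae ?_
      filter_upwards [Lp.coeFn_zero ℂ 2 (volume : Measure (Space d))] with x hx
      rw [hx, Pi.zero_apply, enorm_zero, ENNReal.zero_rpow_of_pos (by positivity)]
    rw [this, mul_zero]
    exact zero_le
  set c : ℂ := (‖u‖ : ℂ) with hc
  have hc0 : c ≠ 0 := by simpa [hc] using hu0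
  have hc0' : ‖c‖ₑ ≠ 0 := by simpa using hc0
  set w : L2 (Space d) := c⁻¹ • u with hw
  have huw : u = c • w := by rw [hw, smul_smul, mul_inv_cancel₀ hc0, one_smul]
  have hw1 : ‖w‖ = 1 := by
    rw [hw, norm_smul, norm_inv, hc, Complex.norm_real, norm_norm,
      inv_mul_cancel₀ (norm_ne_zero_iff.2 hu0)]
  have hwH : MemHs s w := by
    rw [MemHs, hw, fracForm_smul]
    exact ENNReal.mul_lt_top (by simp) hu
  have key := interpolation_of_liebThirring_of_norm_eq_one hs hsd hs1 hC h hw1 hwH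
  rw [huw, fracForm_smul, rieszEnergy_smul, lintegral_enorm_rpow_smul (by positivity),
    ENNReal.mul_rpow_of_nonneg _ _ (by linarith), ENNReal.mul_rpow_of_nonneg _ _ hθ0.le,
    mul_left_comm, mul_mul_mul_comm]
  refine mul_le_mul' (le_of_eq ?_) key
  rw [← ENNReal.rpow_natCast, ← ENNReal.rpow_natCast, ← ENNReal.rpow_mul, ← ENNReal.rpow_mul,
    ← ENNReal.rpow_add _ _ hc0' enorm_ne_top]
  congr 1
  push_cast
  ring

end OneBody

/-! ### The root of the density -/

section HoffmannOstenhof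

lemma rpow_half_rpow_two (x : ℝ≥0∞) : (x ^ (1 / 2 : ℝ)) ^ (2 : ℝ) = x := by
  rw [← ENNReal.rpow_mul]
  norm_num

lemma rpow_half_sq (x : ℝ≥0∞) : (x ^ (1 / 2 : ℝ)) ^ 2 = x := by
  rw [← ENNReal.rpow_two, rpow_half_rpow_two]

/-- Minkowski's inequality in `L²`. -/
lemma lintegral_sq_rpow_half_le {X : Type*} [MeasurableSpace X] {μ : Measure X}
    {f g e : X → ℝ≥0∞} (hg : Measurable g) (he : Measurable e) (h : ∀ x, f x ≤ g x + e x) :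
    (∫⁻ x, f x ^ 2 ∂μ) ^ (1 / 2 : ℝ)
      ≤ (∫⁻ x, g x ^ 2 ∂μ) ^ (1 / 2 : ℝ) + (∫⁻ x, e x ^ 2 ∂μ) ^ (1 / 2 : ℝ) := by
  have := ENNReal.lintegral_Lp_add_le (μ := μ) hg.aemeasurable he.aemeasurable one_le_two
  simp only [ENNReal.rpow_two, Pi.add_apply] at this
  refine le_trans ?_ this
  gcongr with x
  exact h x

/-- Minkowski's inequality in `ℓ²`, for numbers given through their squares. -/
lemma sum_rpow_half_le {ι : Type*} [Fintype ι] {A B e : ι → ℝ≥0∞}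
    (h : ∀ i, A i ^ (1 / 2 : ℝ) ≤ B i ^ (1 / 2 : ℝ) + e i ^ (1 / 2 : ℝ)) :
    (∑ i, A i) ^ (1 / 2 : ℝ) ≤ (∑ i, B i) ^ (1 / 2 : ℝ) + (∑ i, e i) ^ (1 / 2 : ℝ) := by
  have := ENNReal.Lp_add_le Finset.univ (fun i => B i ^ (1 / 2 : ℝ)) (fun i => e i ^ (1 / 2 : ℝ))
    one_le_two
  simp only [rpow_half_rpow_two] at this
  refine le_trans ?_ this
  gcongr with i
  calc A i = (A i ^ (1 / 2 : ℝ)) ^ (2 : ℝ) := (rpow_half_rpow_two _).symm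
    _ ≤ _ := ENNReal.rpow_le_rpow (h i) zero_le_two

variable {N d : ℕ}

/-- The density of the increments of `Ψ` when one particle is displaced by `h`. -/
def incrementDensity (Ψ : L2 (Config N d)) (h x : Space d) : ℝ≥0∞ :=
  ∑ i : Fin N, lmarginal (fun _ : Fin N => (volume : Measure (Space d))) {i}ᶜ
    (fun y => ‖Ψ (assemble (Function.update y i (y i + h))) - Ψ (assemble y)‖ₑ ^ 2) (fun _ => x)

lemma measurable_incrementIntegrand (Ψ : L2 (Config N d)) (i : Fin N) (h : Space d) :
    Measurable fun y : Fin N → Space d =>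
      ‖Ψ (assemble (Function.update y i (y i + h))) - Ψ (assemble y)‖ₑ ^ 2 := by
  have h2 := measurable_assemble (N := N) (d := d)
  fun_prop

lemma lintegral_incrementDensity (Ψ : L2 (Config N d)) (k : Fin d) (t : ℝ) :
    ∫⁻ x, incrementDensity Ψ (t • EuclideanSpace.single k 1) x
      = ∑ i, diffSq (t • EuclideanSpace.single (i, k) 1) Ψ := by
  have hm : Measurable Ψ := (Lp.stronglyMeasurable Ψ).measurable
  simp only [incrementDensity]
  rw [lintegral_finsetSum _ fun i _ =>
    measurable_const_lmarginal _ (measurable_incrementIntegrand Ψ i _)]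
  refine Finset.sum_congr rfl fun i _ => ?_
  rw [diffSq_single hm]
  simpa using lintegral_lmarginal_compl i (measurable_incrementIntegrand Ψ i _)
    (measurable_const (a := (1 : ℝ≥0∞)))

lemma updateFinset_compl_add (i : Fin N) (x h : Space d)
    (z : (({i}ᶜ : Finset (Fin N)) → Space d)) :
    Function.updateFinset (fun _ => x + h) {i}ᶜ z
      = Function.update (Function.updateFinset (fun _ => x) {i}ᶜ z) i
          (Function.updateFinset (fun _ => x) {i}ᶜ z i + h) := by
  ext j
  by_cases hj : j = i
  · subst hj
    simp [Function.updateFinset]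
  · simp [Function.updateFinset, hj]

lemma measurable_section (Ψ : L2 (Config N d)) (i : Fin N) (x : Space d) :
    Measurable fun z : (({i}ᶜ : Finset (Fin N)) → Space d) =>
      Ψ (assemble (Function.updateFinset (fun _ => x) {i}ᶜ z)) :=
  (Lp.stronglyMeasurable Ψ).measurable.comp (measurable_assemble.comp measurable_updateFinset)

/-- Increments of `√ρ_Ψ` are dominated by the root of the increment density. -/
lemma sqrt_density_add_le (Ψ : L2 (Config N d)) (h x : Space d) :
    density Ψ (x + h) ^ (1 / 2 : ℝ)
      ≤ density Ψ x ^ (1 / 2 : ℝ) + incrementDensity Ψ h x ^ (1 / 2 : ℝ) := by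
  refine sum_rpow_half_le fun i => ?_
  have h1 := measurable_section Ψ i x
  have h2 := measurable_section Ψ i (x + h)
  simp only [updateFinset_compl_add] at h2
  simp only [lmarginal, updateFinset_compl_add]
  refine lintegral_sq_rpow_half_le (by fun_prop) (by fun_prop) fun z => ?_
  refine le_trans (le_of_eq ?_) (enorm_add_le _ _)
  rw [add_sub_cancel]

lemma sqrt_density_le_add (Ψ : L2 (Config N d)) (h x : Space d) :
    density Ψ x ^ (1 / 2 : ℝ)
      ≤ density Ψ (x + h) ^ (1 / 2 : ℝ) + incrementDensity Ψ h x ^ (1 / 2 : ℝ) := by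
  refine sum_rpow_half_le fun i => ?_
  have h1 := measurable_section Ψ i x
  have h2 := measurable_section Ψ i (x + h)
  simp only [updateFinset_compl_add] at h2
  simp only [lmarginal, updateFinset_compl_add]
  refine lintegral_sq_rpow_half_le (by fun_prop) (by fun_prop) fun z => ?_
  refine le_trans (le_of_eq ?_) enorm_sub_le
  rw [sub_sub_cancel]

/-- The truncated root `min(√ρ_Ψ, M)` of the density. -/
def truncRoot (Ψ : L2 (Config N d)) (M : ℕ) (x : Space d) : ℝ≥0∞ :=
  min (density Ψ x ^ (1 / 2 : ℝ)) M

lemma truncRoot_ne_top (Ψ : L2 (Config N d)) (M : ℕ) (x : Space d) : truncRoot Ψ M x ≠ ∞ :=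
  ((min_le_right _ _).trans_lt (ENNReal.natCast_lt_top M)).ne

lemma measurable_truncRoot (Ψ : L2 (Config N d)) (M : ℕ) : Measurable (truncRoot Ψ M) :=
  ((measurable_density Ψ).pow_const _).min measurable_const

lemma truncRoot_sq_le_density (Ψ : L2 (Config N d)) (M : ℕ) (x : Space d) :
    truncRoot Ψ M x ^ 2 ≤ density Ψ x := by
  calc truncRoot Ψ M x ^ 2 ≤ (density Ψ x ^ (1 / 2 : ℝ)) ^ 2 := by
        gcongr
        exact min_le_left _ _
    _ = _ := rpow_half_sq _

lemma min_le_min_add {a b e M : ℝ≥0∞} (h : a ≤ b + e) : min a M ≤ min b M + e := by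
  rw [← min_add_add_right]
  exact min_le_min h le_self_add

lemma enorm_ofReal_toReal {a : ℝ≥0∞} (ha : a ≠ ∞) : ‖((a.toReal : ℝ) : ℂ)‖ₑ = a := by
  rw [← ofReal_norm, Complex.norm_real, Real.norm_eq_abs, abs_of_nonneg ENNReal.toReal_nonneg,
    ENNReal.ofReal_toReal ha]

lemma enorm_toReal_sub_toReal_le {a b e : ℝ≥0∞} (ha : a ≠ ∞) (hb : b ≠ ∞) (hab : a ≤ b + e)
    (hba : b ≤ a + e) : ‖((a.toReal : ℝ) : ℂ) - ((b.toReal : ℝ) : ℂ)‖ₑ ≤ e := by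
  rcases eq_or_ne e ∞ with rfl | he
  · exact le_top
  rw [← Complex.ofReal_sub, ← ofReal_norm, Complex.norm_real]
  refine ENNReal.ofReal_le_of_le_toReal ?_
  have h1 := (ENNReal.toReal_le_toReal ha (ENNReal.add_ne_top.2 ⟨hb, he⟩)).2 hab
  have h2 := (ENNReal.toReal_le_toReal hb (ENNReal.add_ne_top.2 ⟨ha, he⟩)).2 hba
  rw [ENNReal.toReal_add hb he] at h1
  rw [ENNReal.toReal_add ha he] at h2
  rw [Real.norm_eq_abs, abs_le]
  constructor <;> linarith

lemma diffSq_truncRoot_le (Ψ : L2 (Config N d)) (M : ℕ) (h : Space d) :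
    diffSq h (fun x => ((truncRoot Ψ M x).toReal : ℂ)) ≤ ∫⁻ x, incrementDensity Ψ h x := by
  refine lintegral_mono fun x => ?_
  calc ‖((truncRoot Ψ M (x + h)).toReal : ℂ) - ((truncRoot Ψ M x).toReal : ℂ)‖ₑ ^ 2
      ≤ (incrementDensity Ψ h x ^ (1 / 2 : ℝ)) ^ 2 := by
        gcongr
        exact enorm_toReal_sub_toReal_le (truncRoot_ne_top _ _ _) (truncRoot_ne_top _ _ _)
          (min_le_min_add (sqrt_density_add_le Ψ h x)) (min_le_min_add (sqrt_density_le_add Ψ h x))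
    _ = _ := rpow_half_sq _

lemma memLp_truncRoot {Ψ : L2 (Config N d)} (hΨ : ‖Ψ‖ = 1) (M : ℕ) :
    MemLp (fun x => ((truncRoot Ψ M x).toReal : ℂ)) 2 volume := by
  have hm := measurable_truncRoot Ψ M
  refine memLp_two_of_lintegral_lt_top (by fun_prop) ?_
  simp_rw [enorm_ofReal_toReal (truncRoot_ne_top Ψ M _)]
  refine (lintegral_mono (truncRoot_sq_le_density Ψ M)).trans_lt ?_
  rw [lintegral_density hΨ]
  exact ENNReal.natCast_lt_top N

/-- The truncated root of the density as an element of `L²`. -/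
def truncRootL2 {Ψ : L2 (Config N d)} (hΨ : ‖Ψ‖ = 1) (M : ℕ) : L2 (Space d) :=
  (memLp_truncRoot hΨ M).toLp

lemma enorm_truncRootL2 {Ψ : L2 (Config N d)} (hΨ : ‖Ψ‖ = 1) (M : ℕ) :
    ∀ᵐ x, ‖truncRootL2 hΨ M x‖ₑ = truncRoot Ψ M x := by
  filter_upwards [(memLp_truncRoot hΨ M).coeFn_toLp] with x hx
  rw [truncRootL2, hx, enorm_ofReal_toReal (truncRoot_ne_top Ψ M x)]

/-- A fractional Hoffmann-Ostenhof inequality, with the constant `d` coming from the comparison of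
`|ξ|^{2s}` with `∑ |ξ_k|^{2s}`. Taking roots of densities contracts increments by Minkowski's
inequality, and so does truncation. -/
theorem fracForm_truncRootL2_le {s : ℝ} (hs : 0 < s) (hs1 : s ≤ 1) {Ψ : L2 (Config N d)}
    (hΨ : ‖Ψ‖ = 1) (M : ℕ) : fracForm s (truncRootL2 hΨ M) ≤ d * kineticEnergy s Ψ := by
  refine (fracForm_le_sum_dirForm hs hs1 _).trans ?_
  have h : ∀ k : Fin d, dirForm s (EuclideanSpace.single k 1) (truncRootL2 hΨ M)
      ≤ kineticEnergy s Ψ := by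
    intro k
    refine (dirForm_le_sum_of_diffSq_le hs hs1 _ _
      (fun i : Fin N => EuclideanSpace.single (i, k) (1 : ℝ)) (fun _ => Ψ) fun t => ?_).trans
      (sum_dirForm_le_kineticEnergy hs k Ψ)
    rw [truncRootL2, diffSq_congr_ae (memLp_truncRoot hΨ M).coeFn_toLp,
      ← lintegral_incrementDensity]
    exact diffSq_truncRoot_le Ψ M _
  refine (Finset.sum_le_sum fun k _ => h k).trans (le_of_eq ?_)
  simp

end HoffmannOstenhof

/-! ### Averages over balls -/

section LiebOxford

variable {d : ℕ}

/-- Indicator of `x ∈ B(z, r)`. -/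
def ballInd (r : ℝ) (z x : Space d) : ℝ≥0∞ := (Metric.ball z r).indicator 1 x

@[fun_prop]
lemma measurable_ballInd {X : Type*} [MeasurableSpace X] {r : X → ℝ} {z x : X → Space d}
    (hr : Measurable r) (hz : Measurable z) (hx : Measurable x) :
    Measurable fun a => ballInd (r a) (z a) (x a) := by
  have h : MeasurableSet {a | dist (x a) (z a) < r a} := measurableSet_lt (hx.dist hz) hr
  exact (measurable_const (a := (1 : ℝ≥0∞))).indicator h

lemma ballInd_comm (r : ℝ) (z x : Space d) : ballInd r z x = ballInd r x z := by
  have h : x ∈ Metric.ball z r ↔ z ∈ Metric.ball x r := Metric.mem_ball_comm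
  by_cases hx : x ∈ Metric.ball z r
  · simp [ballInd, hx, h.1 hx]
  · simp [ballInd, hx, mt h.2 hx]

lemma lintegral_ballInd_mul (r : ℝ) (z : Space d) (f : Space d → ℝ≥0∞) :
    ∫⁻ x, ballInd r z x * f x = ∫⁻ x in Metric.ball z r, f x := by
  rw [← lintegral_indicator measurableSet_ball]
  refine lintegral_congr fun x => ?_
  by_cases hx : x ∈ Metric.ball z r <;> simp [ballInd, hx]

/-- Volume of the unit ball of `ℝ^d`. -/
def unitVol (d : ℕ) : ℝ≥0∞ := volume (Metric.ball (0 : Space d) 1)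

lemma unitVol_ne_zero : unitVol d ≠ 0 := (Metric.measure_ball_pos _ _ one_pos).ne'

lemma unitVol_ne_top : unitVol d ≠ ∞ := measure_ball_lt_top.ne

lemma volume_ball_eq {r : ℝ} (hr : 0 < r) (x : Space d) :
    volume (Metric.ball x r) = ENNReal.ofReal (r ^ d) * unitVol d := by
  rw [Measure.addHaar_ball_of_pos _ _ hr, finrank_euclideanSpace_fin, unitVol]

lemma lintegral_ballInd {r : ℝ} (hr : 0 < r) (x : Space d) :
    ∫⁻ z, ballInd r z x = ENNReal.ofReal (r ^ d) * unitVol d := by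
  simp_rw [ballInd_comm r _ x]
  have := lintegral_ballInd_mul r x (fun _ => 1)
  simp only [mul_one, setLIntegral_one] at this
  rw [this, volume_ball_eq hr]

/-- Superposition of indicators of balls of all centres and radii, with weight `r^{-1-d-p}`. -/
def ballAverage (p : ℝ) (Φ : ℝ → Space d → ℝ≥0∞) : ℝ≥0∞ :=
  ∫⁻ r in Set.Ioi (0 : ℝ), ENNReal.ofReal (r ^ (-1 - d - p)) * ∫⁻ z, Φ r z

lemma ballAverage_mono {p : ℝ} {Φ Φ' : ℝ → Space d → ℝ≥0∞} (h : ∀ r, 0 < r → ∀ z, Φ r z ≤ Φ' r z) :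
    ballAverage p Φ ≤ ballAverage p Φ' := by
  refine setLIntegral_mono' measurableSet_Ioi fun r hr => ?_
  gcongr with z
  exact h r hr z

lemma ballAverage_add {p : ℝ} {Φ Φ' : ℝ → Space d → ℝ≥0∞}
    (h : Measurable fun a : ℝ × Space d => Φ a.1 a.2) :
    ballAverage p (fun r z => Φ r z + Φ' r z) = ballAverage p Φ + ballAverage p Φ' := by
  have hr : ∀ r, Measurable (Φ r) := fun r => h.comp (by fun_prop : Measurable fun z => (r, z))
  simp only [ballAverage]
  rw [← lintegral_add_left (by fun_prop)]
  refine lintegral_congr fun r => ?_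
  rw [lintegral_add_left (hr r), mul_add]

lemma ballAverage_const_mul {p : ℝ} {c : ℝ≥0∞} (hc : c ≠ ∞) (Φ : ℝ → Space d → ℝ≥0∞) :
    ballAverage p (fun r z => c * Φ r z) = c * ballAverage p Φ := by
  simp only [ballAverage]
  rw [← lintegral_const_mul' _ _ hc]
  refine lintegral_congr fun r => ?_
  rw [lintegral_const_mul' _ _ hc, mul_left_comm]

/-- Tonelli's theorem for `ballAverage`. -/
lemma ballAverage_lintegral {X : Type*} [MeasurableSpace X] {μ : Measure X} [SFinite μ] {p : ℝ}
    {Φ : X → ℝ → Space d → ℝ≥0∞}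
    (h : Measurable fun a : X × ℝ × Space d => Φ a.1 a.2.1 a.2.2) :
    ballAverage p (fun r z => ∫⁻ x, Φ x r z ∂μ) = ∫⁻ x, ballAverage p (Φ x) ∂μ := by
  have h1 : ∀ r, Measurable fun a : Space d × X => Φ a.2 r a.1 := fun r =>
    h.comp (by fun_prop : Measurable fun a : Space d × X => (a.2, r, a.1))
  have h2 : Measurable fun a : (ℝ × X) × Space d => Φ a.1.2 a.1.1 a.2 :=
    h.comp (by fun_prop : Measurable fun a : (ℝ × X) × Space d => (a.1.2, a.1.1, a.2))
  have h3 : Measurable fun a : ℝ × X => ∫⁻ z, Φ a.2 a.1 z := h2.lintegral_prod_right'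
  simp only [ballAverage]
  rw [← lintegral_lintegral_swap (by fun_prop)]
  refine lintegral_congr fun r => ?_
  have h4 : Measurable fun x => ∫⁻ z, Φ x r z :=
    h3.comp (by fun_prop : Measurable fun x : X => (r, x))
  rw [lintegral_const_mul _ h4, lintegral_lintegral_swap (h1 r).aemeasurable]

/-- The kernel obtained by averaging `1_B(x) 1_B(y)` over balls `B`; it is comparable to
`|x - y|^{-p}`. -/
def ballKernel (p : ℝ) (x y : Space d) : ℝ≥0∞ :=
  ballAverage p fun r z => ballInd r z x * ballInd r z y

lemma weight_mul_pow {r p : ℝ} (hr : 0 < r) :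
    ENNReal.ofReal (r ^ (-1 - d - p)) * ENNReal.ofReal (r ^ d) = ENNReal.ofReal (r ^ (-1 - p)) := by
  rw [← ENNReal.ofReal_mul (by positivity), ← Real.rpow_natCast, ← Real.rpow_add hr]
  ring_nf

lemma one_div_enorm_rpow {p : ℝ} {v : Space d} (hv : v ≠ 0) :
    1 / ‖v‖ₑ ^ p = ENNReal.ofReal (‖v‖ ^ (-p)) := by
  have h : 0 < ‖v‖ := norm_pos_iff.2 hv
  rw [← ofReal_norm, ENNReal.ofReal_rpow_of_pos h, one_div,
    ← ENNReal.ofReal_inv_of_pos (Real.rpow_pos_of_pos h _), Real.rpow_neg h.le]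

lemma ballKernel_le {p : ℝ} (hp : 0 < p) (x y : Space d) :
    ballKernel p x y ≤ unitVol d * ENNReal.ofReal (2 ^ p / p) * (1 / ‖x - y‖ₑ ^ p) := by
  rcases eq_or_ne x y with rfl | hxy
  · rw [sub_self, enorm_zero, ENNReal.zero_rpow_of_pos hp, one_div, ENNReal.inv_zero,
      ENNReal.mul_top]
    · exact le_top
    · refine mul_ne_zero unitVol_ne_zero (ENNReal.ofReal_pos.2 ?_).ne'
      positivity
  have hρ : 0 < ‖x - y‖ := norm_pos_iff.2 (sub_ne_zero.2 hxy)
  -- two points of a common ball of radius `r` are at distance less than `2r`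
  have hle : ∀ r, 0 < r → ENNReal.ofReal (r ^ (-1 - d - p)) * ∫⁻ z, ballInd r z x * ballInd r z y
      ≤ (Set.Ioi (‖x - y‖ / 2)).indicator
        (fun r => unitVol d * ENNReal.ofReal (r ^ (-1 - p))) r := by
    intro r hr
    by_cases hr2 : ‖x - y‖ / 2 < r
    · rw [Set.indicator_of_mem (Set.mem_Ioi.2 hr2), ← weight_mul_pow (d := d) hr, ← mul_assoc,
        mul_comm (unitVol d), mul_assoc, mul_comm (unitVol d), ← lintegral_ballInd hr x]
      gcongr with z
      calc ballInd r z x * ballInd r z y ≤ ballInd r z x * 1 := by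
            gcongr
            exact Set.indicator_le_self' (fun _ _ => zero_le) _
        _ = _ := mul_one _
    · have h0 : ∀ z, ballInd r z x * ballInd r z y = 0 := by
        intro z
        by_contra hne
        rw [mul_eq_zero, not_or] at hne
        have h1 : x ∈ Metric.ball z r := Set.mem_of_indicator_ne_zero hne.1
        have h2 : y ∈ Metric.ball z r := Set.mem_of_indicator_ne_zero hne.2
        have h3 := dist_triangle_right x y z
        rw [Metric.mem_ball] at h1 h2
        rw [dist_eq_norm x y] at h3
        linarith
      simp [h0]
  calc ballKernel p x y
      ≤ ∫⁻ r in Set.Ioi (0 : ℝ), (Set.Ioi (‖x - y‖ / 2)).indicator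
        (fun r => unitVol d * ENNReal.ofReal (r ^ (-1 - p))) r :=
        setLIntegral_mono' measurableSet_Ioi hle
    _ ≤ ∫⁻ r, (Set.Ioi (‖x - y‖ / 2)).indicator
        (fun r => unitVol d * ENNReal.ofReal (r ^ (-1 - p))) r := setLIntegral_le_lintegral _ _
    _ = unitVol d * ENNReal.ofReal ((‖x - y‖ / 2) ^ (-p) / p) := by
        rw [lintegral_indicator measurableSet_Ioi, lintegral_const_mul _ (by fun_prop),
          lintegral_Ioi_rpow hp (by positivity)]
    _ = _ := by
        rw [one_div_enorm_rpow (sub_ne_zero.2 hxy), mul_assoc, ← ENNReal.ofReal_mul (by positivity)]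
        congr 2
        rw [Real.div_rpow hρ.le zero_le_two, Real.rpow_neg zero_le_two]
        field_simp

lemma le_ballKernel {p : ℝ} (hp : 0 < p) {x y : Space d} (hxy : x ≠ y) :
    unitVol d * ENNReal.ofReal ((2 ^ d)⁻¹ / p) * (1 / ‖x - y‖ₑ ^ p) ≤ ballKernel p x y := by
  have hρ : 0 < ‖x - y‖ := norm_pos_iff.2 (sub_ne_zero.2 hxy)
  -- for `r > |x - y|` the ball of radius `r / 2` about the midpoint lies in both balls
  have hsub : ∀ r, ‖x - y‖ < r →
      ENNReal.ofReal ((r / 2) ^ d) * unitVol d ≤ ∫⁻ z, ballInd r z x * ballInd r z y := by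
    intro r hr
    have hr0 : 0 < r := hρ.trans hr
    rw [← lintegral_ballInd (by positivity) (midpoint ℝ x y)]
    refine lintegral_mono fun z => ?_
    by_cases hz : midpoint ℝ x y ∈ Metric.ball z (r / 2)
    · have hm1 : dist x (midpoint ℝ x y) = ‖x - y‖ / 2 := by
        rw [dist_left_midpoint, dist_eq_norm, Real.norm_ofNat]
        ring
      have hm2 : dist y (midpoint ℝ x y) = ‖x - y‖ / 2 := by
        rw [dist_right_midpoint, dist_eq_norm, Real.norm_ofNat]
        ring
      rw [Metric.mem_ball] at hz
      have hx : x ∈ Metric.ball z r := by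
        rw [Metric.mem_ball]
        have := dist_triangle x (midpoint ℝ x y) z
        linarith
      have hy : y ∈ Metric.ball z r := by
        rw [Metric.mem_ball]
        have := dist_triangle y (midpoint ℝ x y) z
        linarith
      simp only [ballInd, Set.indicator_of_mem hx, Set.indicator_of_mem hy, Pi.one_apply, mul_one]
      exact Set.indicator_le_self' (fun _ _ => zero_le) _
    · simp [ballInd, hz]
  calc unitVol d * ENNReal.ofReal ((2 ^ d)⁻¹ / p) * (1 / ‖x - y‖ₑ ^ p)
      = ∫⁻ r in Set.Ioi ‖x - y‖, unitVol d * ENNReal.ofReal ((2 ^ d)⁻¹)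
          * ENNReal.ofReal (r ^ (-1 - p)) := by
        rw [one_div_enorm_rpow (sub_ne_zero.2 hxy), lintegral_const_mul _ (by fun_prop),
          lintegral_Ioi_rpow hp hρ, mul_assoc, mul_assoc, ← ENNReal.ofReal_mul (by positivity),
          ← ENNReal.ofReal_mul (by positivity)]
        congr 2
        ring
    _ ≤ ∫⁻ r in Set.Ioi ‖x - y‖,
          ENNReal.ofReal (r ^ (-1 - d - p)) * ∫⁻ z, ballInd r z x * ballInd r z y := by
        refine setLIntegral_mono' measurableSet_Ioi fun r hr => ?_
        have hr0 : 0 < r := hρ.trans hr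
        refine le_trans (le_of_eq ?_) (mul_le_mul_right (hsub r hr) _)
        rw [div_pow, div_eq_mul_inv, ENNReal.ofReal_mul (by positivity),
          ← weight_mul_pow (d := d) hr0]
        ring
    _ ≤ ballKernel p x y := lintegral_mono_set (Set.Ioi_subset_Ioi hρ.le)

/-- Cauchy–Schwarz. -/
lemma sq_lintegral_mul_le {X : Type*} [MeasurableSpace X] {μ : Measure X} {f g : X → ℝ≥0∞}
    (hf : Measurable f) (hg : Measurable g) :
    (∫⁻ x, f x * g x ∂μ) ^ 2 ≤ (∫⁻ x, f x ^ 2 ∂μ) * ∫⁻ x, g x ^ 2 ∂μ := by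
  have h := ENNReal.lintegral_mul_le_Lp_mul_Lq μ Real.HolderConjugate.two_two hf.aemeasurable
    hg.aemeasurable
  simp only [ENNReal.rpow_two, Pi.mul_apply] at h
  calc _ ≤ _ := pow_le_pow_left₀ zero_le h 2
    _ = _ := by rw [mul_pow, rpow_half_sq, rpow_half_sq]

end LiebOxford

/-! ### The self-energy bound -/

section SelfEnergy

variable {d : ℕ}

/-- The contribution of large radii is removed by the condition `a ≤ r^{-d}`. -/
lemma lintegral_low_level {p : ℝ} (hd : 0 < d) (hpd : p < d) {a : ℝ≥0∞} (ha : a ≠ ∞) :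
    ∫⁻ r in Set.Ioi (0 : ℝ), ENNReal.ofReal (r ^ (-1 - d - p)) * ENNReal.ofReal (r ^ d) ^ 2
        * (if a ≤ ENNReal.ofReal ((r ^ d)⁻¹) then a ^ 2 else 0)
      ≤ ENNReal.ofReal (1 / (d - p)) * a ^ (1 + p / d) := by
  rcases eq_or_ne a 0 with rfl | ha0
  · simp
  lift a to NNReal using ha
  have hα : 0 < (a : ℝ) := by
    rw [NNReal.coe_pos]
    exact pos_iff_ne_zero.2 (by simpa using ha0)
  set R : ℝ := (a : ℝ) ^ (-(1 / (d : ℝ))) with hR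
  have hR0 : 0 < R := Real.rpow_pos_of_pos hα _
  have hmem : ∀ r : ℝ, 0 < r → (a : ℝ≥0∞) ≤ ENNReal.ofReal ((r ^ d)⁻¹) → r ≤ R := by
    intro r hr h
    rw [← ENNReal.ofReal_coe_nnreal, ENNReal.ofReal_le_ofReal_iff (by positivity)] at h
    have h2 := Real.rpow_le_rpow_of_nonpos hα h
      (neg_nonpos.2 (by positivity : (0 : ℝ) ≤ 1 / (d : ℝ)))
    rwa [Real.inv_rpow (by positivity), Real.rpow_neg (by positivity), inv_inv, one_div,
      Real.pow_rpow_inv_natCast hr.le hd.ne', ← one_div] at h2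
  calc _ ≤ ∫⁻ r in Set.Ioi (0 : ℝ), (Set.Ioc 0 R).indicator
          (fun r => ENNReal.ofReal (r ^ ((d - p) - 1)) * (a : ℝ≥0∞) ^ 2) r := by
        refine setLIntegral_mono' measurableSet_Ioi fun r hr => ?_
        have hr : 0 < r := hr
        split_ifs with h
        · have hrR : r ∈ Set.Ioc 0 R := ⟨hr, hmem r hr h⟩
          rw [Set.indicator_of_mem hrR, sq (ENNReal.ofReal (r ^ d)), ← mul_assoc,
            weight_mul_pow hr, ← ENNReal.ofReal_mul (by positivity), ← Real.rpow_natCast r d,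
            ← Real.rpow_add hr]
          ring_nf
          exact le_rfl
        · rw [mul_zero]
          exact zero_le
    _ ≤ ∫⁻ r, (Set.Ioc 0 R).indicator
          (fun r => ENNReal.ofReal (r ^ ((d - p) - 1)) * (a : ℝ≥0∞) ^ 2) r :=
        setLIntegral_le_lintegral _ _
    _ = ENNReal.ofReal (R ^ (d - p) / (d - p)) * (a : ℝ≥0∞) ^ 2 := by
        rw [lintegral_indicator measurableSet_Ioc, lintegral_mul_const _ (by fun_prop),
          lintegral_Ioc_rpow (by linarith) hR0.le]
    _ = _ := by
        rw [← ENNReal.ofReal_coe_nnreal, ENNReal.ofReal_rpow_of_pos hα,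
          ← ENNReal.ofReal_pow hα.le, ← ENNReal.ofReal_mul (by positivity),
          ← ENNReal.ofReal_mul (by positivity), hR, ← Real.rpow_mul hα.le, div_mul_eq_mul_div,
          ← Real.rpow_natCast, ← Real.rpow_add hα, one_div_mul_eq_div]
        congr 3
        push_cast
        field_simp
        ring

/-- The contribution of small radii is removed by the condition `a > r^{-d}`. -/
lemma lintegral_high_level {p : ℝ} (hd : 0 < d) (hp : 0 < p) {a : ℝ≥0∞} (ha : a ≠ ∞) :
    ∫⁻ r in Set.Ioi (0 : ℝ), ENNReal.ofReal (r ^ (-1 - d - p)) * ENNReal.ofReal (r ^ d)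
        * (if a ≤ ENNReal.ofReal ((r ^ d)⁻¹) then 0 else a)
      ≤ ENNReal.ofReal (1 / p) * a ^ (1 + p / d) := by
  rcases eq_or_ne a 0 with rfl | ha0
  · simp
  lift a to NNReal using ha
  have hα : 0 < (a : ℝ) := by
    rw [NNReal.coe_pos]
    exact pos_iff_ne_zero.2 (by simpa using ha0)
  set R : ℝ := (a : ℝ) ^ (-(1 / (d : ℝ))) with hR
  have hR0 : 0 < R := Real.rpow_pos_of_pos hα _
  have hmem : ∀ r : ℝ, 0 < r → ¬ (a : ℝ≥0∞) ≤ ENNReal.ofReal ((r ^ d)⁻¹) → R < r := by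
    intro r hr h
    rw [← ENNReal.ofReal_coe_nnreal, ENNReal.ofReal_le_ofReal_iff (by positivity), not_le] at h
    have h2 := Real.rpow_lt_rpow_of_neg (by positivity) h
      (neg_lt_zero.2 (by positivity : (0 : ℝ) < 1 / (d : ℝ)))
    rwa [Real.inv_rpow (by positivity), Real.rpow_neg (pow_nonneg hr.le _), inv_inv, one_div,
      Real.pow_rpow_inv_natCast hr.le hd.ne', ← one_div] at h2
  calc _ ≤ ∫⁻ r in Set.Ioi (0 : ℝ), (Set.Ioi R).indicator
          (fun r => ENNReal.ofReal (r ^ (-1 - p)) * (a : ℝ≥0∞)) r := by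
        refine setLIntegral_mono' measurableSet_Ioi fun r hr => ?_
        have hr : 0 < r := hr
        split_ifs with h
        · rw [mul_zero]
          exact zero_le
        · rw [Set.indicator_of_mem (Set.mem_Ioi.2 (hmem r hr h)), weight_mul_pow hr]
    _ ≤ ∫⁻ r, (Set.Ioi R).indicator
          (fun r => ENNReal.ofReal (r ^ (-1 - p)) * (a : ℝ≥0∞)) r :=
        setLIntegral_le_lintegral _ _
    _ = ENNReal.ofReal (R ^ (-p) / p) * (a : ℝ≥0∞) := by
        rw [lintegral_indicator measurableSet_Ioi, lintegral_mul_const _ (by fun_prop),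
          lintegral_Ioi_rpow hp hR0]
    _ = _ := by
        rw [← ENNReal.ofReal_coe_nnreal, ENNReal.ofReal_rpow_of_pos hα,
          ← ENNReal.ofReal_mul (by positivity), ← ENNReal.ofReal_mul (by positivity), hR,
          ← Real.rpow_mul hα.le, div_mul_eq_mul_div, one_div_mul_eq_div]
        congr 2
        nth_rewrite 2 [← Real.rpow_one (a : ℝ)]
        rw [← Real.rpow_add hα]
        congr 1
        field_simp
        ring

/-- The mass of `f` in the ball `B(z, r)`. -/
def ballMass (f : Space d → ℝ≥0∞) (r : ℝ) (z : Space d) : ℝ≥0∞ := ∫⁻ x, ballInd r z x * f x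

lemma lintegral_ballMass {f : Space d → ℝ≥0∞} (hf : Measurable f) {r : ℝ} (hr : 0 < r) :
    ∫⁻ z, ballMass f r z = ENNReal.ofReal (r ^ d) * unitVol d * ∫⁻ x, f x := by
  simp only [ballMass]
  rw [lintegral_lintegral_swap (by fun_prop), ← lintegral_const_mul _ hf]
  refine lintegral_congr fun x => ?_
  rw [lintegral_mul_const _ (by fun_prop), lintegral_ballInd hr]

lemma ballInd_sq (r : ℝ) (z x : Space d) : ballInd r z x ^ 2 = ballInd r z x := by
  by_cases hx : x ∈ Metric.ball z r <;> simp [ballInd, hx]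

/-- Cauchy–Schwarz on a ball. -/
lemma ballMass_sq_le {f : Space d → ℝ≥0∞} (hf : Measurable f) {r : ℝ} (hr : 0 < r) (z : Space d) :
    ballMass f r z ^ 2
      ≤ ENNReal.ofReal (r ^ d) * unitVol d * ballMass (fun x => f x ^ 2) r z := by
  have h := sq_lintegral_mul_le (μ := (volume : Measure (Space d)))
    (f := fun x => ballInd r z x) (g := fun x => ballInd r z x * f x) (by fun_prop) (by fun_prop)
  simp only [← mul_assoc, ← sq, mul_pow, ballInd_sq] at h
  refine h.trans (le_of_eq ?_)
  simp_rw [ballInd_comm r z]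
  rw [lintegral_ballInd hr]
  simp_rw [← ballInd_comm r z]
  rfl

lemma min_sq_add_le (a b : ℝ≥0∞) : min ((a + b) ^ 2) (a + b) ≤ 4 * a ^ 2 + 2 * b := by
  rcases le_total a b with h | h
  · calc min ((a + b) ^ 2) (a + b) ≤ b + b := (min_le_right _ _).trans (by gcongr)
      _ = 2 * b := (two_mul b).symm
      _ ≤ _ := le_add_self
  · calc min ((a + b) ^ 2) (a + b) ≤ (a + a) ^ 2 := (min_le_left _ _).trans (by gcongr)
      _ = 4 * a ^ 2 := by ring
      _ ≤ _ := le_self_add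

/-- The self-energy bound: for balls of radius `r`, the part of `f` below the level `r^{-d}` is
estimated by Cauchy–Schwarz and the part above that level linearly. -/
lemma ballAverage_min_le {p : ℝ} (hd : 0 < d) (hp : 0 < p) (hpd : p < d) {f : Space d → ℝ≥0∞}
    (hf : Measurable f) (hft : ∀ x, f x ≠ ∞) :
    ballAverage p (fun r z => min (ballMass f r z ^ 2) (ballMass f r z))
      ≤ (4 * (unitVol d ^ 2 * ENNReal.ofReal (1 / (d - p)))
          + 2 * (unitVol d * ENNReal.ofReal (1 / p))) * ∫⁻ x, f x ^ (1 + p / d) := by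
  let f₁ : ℝ → Space d → ℝ≥0∞ := fun r x => if f x ≤ ENNReal.ofReal ((r ^ d)⁻¹) then f x else 0
  let f₂ : ℝ → Space d → ℝ≥0∞ := fun r x => if f x ≤ ENNReal.ofReal ((r ^ d)⁻¹) then 0 else f x
  have hset : MeasurableSet {a : ℝ × Space d | f a.2 ≤ ENNReal.ofReal ((a.1 ^ d)⁻¹)} :=
    measurableSet_le (by fun_prop) (by fun_prop)
  have hm₁ : Measurable fun a : ℝ × Space d => f₁ a.1 a.2 :=
    Measurable.ite hset (by fun_prop) measurable_const
  have hm₂ : Measurable fun a : ℝ × Space d => f₂ a.1 a.2 :=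
    Measurable.ite hset measurable_const (by fun_prop)
  have hr₁ : ∀ r, Measurable (f₁ r) := fun r =>
    hm₁.comp (by fun_prop : Measurable fun x : Space d => (r, x))
  have hr₂ : ∀ r, Measurable (f₂ r) := fun r =>
    hm₂.comp (by fun_prop : Measurable fun x : Space d => (r, x))
  have hsplit : ∀ r z, ballMass f r z = ballMass (f₁ r) r z + ballMass (f₂ r) r z := by
    intro r z
    have := hr₁ r
    simp only [ballMass]
    rw [← lintegral_add_left (by fun_prop)]
    refine lintegral_congr fun x => ?_
    rw [← mul_add]
    congr 1
    simp only [f₁, f₂]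
    split_ifs <;> simp
  have hlow : ballAverage p (fun r z => ballMass (f₁ r) r z ^ 2)
      ≤ unitVol d ^ 2 * ENNReal.ofReal (1 / (d - p)) * ∫⁻ x, f x ^ (1 + p / d) := by
    calc ballAverage p (fun r z => ballMass (f₁ r) r z ^ 2)
        ≤ ∫⁻ r in Set.Ioi (0 : ℝ), ∫⁻ x, unitVol d ^ 2 * (ENNReal.ofReal (r ^ (-1 - d - p))
            * ENNReal.ofReal (r ^ d) ^ 2 * f₁ r x ^ 2) := by
          refine setLIntegral_mono' measurableSet_Ioi fun r hr => ?_
          have hr : 0 < r := hr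
          calc _ ≤ ENNReal.ofReal (r ^ (-1 - d - p)) * ∫⁻ z, ENNReal.ofReal (r ^ d) * unitVol d
                  * ballMass (fun x => f₁ r x ^ 2) r z := by
                gcongr with z
                exact ballMass_sq_le (hr₁ r) hr z
            _ = _ := by
                have := (hr₁ r).pow_const 2
                rw [lintegral_const_mul' _ _ (ENNReal.mul_ne_top ENNReal.ofReal_ne_top
                  unitVol_ne_top), lintegral_ballMass this hr,
                  lintegral_const_mul _ (by fun_prop), lintegral_const_mul _ this]
                ring
      _ = ∫⁻ x, ∫⁻ r in Set.Ioi (0 : ℝ), unitVol d ^ 2 * (ENNReal.ofReal (r ^ (-1 - d - p))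
            * ENNReal.ofReal (r ^ d) ^ 2 * f₁ r x ^ 2) :=
          lintegral_lintegral_swap (by fun_prop)
      _ ≤ ∫⁻ x, unitVol d ^ 2 * (ENNReal.ofReal (1 / (d - p)) * f x ^ (1 + p / d)) := by
          refine lintegral_mono fun x => ?_
          simp only
          rw [lintegral_const_mul' _ _ (ENNReal.pow_ne_top unitVol_ne_top)]
          gcongr
          refine le_trans (le_of_eq (lintegral_congr fun r => ?_))
            (lintegral_low_level hd hpd (hft x))
          congr 1
          simp only [f₁]
          split_ifs <;> simp
      _ = _ := by
          rw [lintegral_const_mul _ (by fun_prop), lintegral_const_mul _ (by fun_prop), mul_assoc]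
  have hhigh : ballAverage p (fun r z => ballMass (f₂ r) r z)
      ≤ unitVol d * ENNReal.ofReal (1 / p) * ∫⁻ x, f x ^ (1 + p / d) := by
    calc ballAverage p (fun r z => ballMass (f₂ r) r z)
        = ∫⁻ r in Set.Ioi (0 : ℝ), ∫⁻ x, unitVol d * (ENNReal.ofReal (r ^ (-1 - d - p))
            * ENNReal.ofReal (r ^ d) * f₂ r x) := by
          refine setLIntegral_congr_fun measurableSet_Ioi fun r hr => ?_
          have hr : 0 < r := hr
          have := hr₂ r
          simp only
          rw [lintegral_ballMass this hr, lintegral_const_mul _ (by fun_prop),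
            lintegral_const_mul _ this]
          ring
      _ = ∫⁻ x, ∫⁻ r in Set.Ioi (0 : ℝ), unitVol d * (ENNReal.ofReal (r ^ (-1 - d - p))
            * ENNReal.ofReal (r ^ d) * f₂ r x) :=
          lintegral_lintegral_swap (by fun_prop)
      _ ≤ ∫⁻ x, unitVol d * (ENNReal.ofReal (1 / p) * f x ^ (1 + p / d)) := by
          refine lintegral_mono fun x => ?_
          simp only
          rw [lintegral_const_mul' _ _ unitVol_ne_top]
          gcongr
          exact lintegral_high_level hd hp (hft x)
      _ = _ := by
          rw [lintegral_const_mul _ (by fun_prop), lintegral_const_mul _ (by fun_prop), mul_assoc]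
  have hbm : Measurable fun a : ℝ × Space d => 4 * ballMass (f₁ a.1) a.1 a.2 ^ 2 := by
    have h1 : Measurable fun a : (ℝ × Space d) × Space d =>
        ballInd a.1.1 a.1.2 a.2 * f₁ a.1.1 a.2 := by
      have := hm₁.comp (by fun_prop : Measurable fun a : (ℝ × Space d) × Space d => (a.1.1, a.2))
      exact Measurable.mul (by fun_prop) this
    exact (h1.lintegral_prod_right'.pow_const 2).const_mul 4
  calc _ ≤ ballAverage p (fun r z => 4 * ballMass (f₁ r) r z ^ 2 + 2 * ballMass (f₂ r) r z) := by
        refine ballAverage_mono fun r _ z => ?_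
        rw [hsplit r z]
        exact min_sq_add_le _ _
    _ = 4 * ballAverage p (fun r z => ballMass (f₁ r) r z ^ 2)
          + 2 * ballAverage p (fun r z => ballMass (f₂ r) r z) := by
        rw [ballAverage_add hbm, ballAverage_const_mul (by norm_num),
          ballAverage_const_mul (by norm_num)]
    _ ≤ _ := by
        rw [add_mul, mul_assoc 4, mul_assoc 2]
        gcongr

end SelfEnergy

/-! ### The Lieb–Oxford inequality and the many-body bound -/

section ManyBody

variable {N d : ℕ}

lemma ballAverage_finset_sum {ι : Type*} {p : ℝ} (S : Finset ι) {Φ : ι → ℝ → Space d → ℝ≥0∞}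
    (h : ∀ i, Measurable fun a : ℝ × Space d => Φ i a.1 a.2) :
    ballAverage p (fun r z => ∑ i ∈ S, Φ i r z) = ∑ i ∈ S, ballAverage p (Φ i) := by
  classical
  induction S using Finset.induction_on with
  | empty => simp [ballAverage]
  | insert a S ha ih =>
    simp only [Finset.sum_insert ha]
    rw [ballAverage_add (h a), ih]

/-- Expected number of pairs of particles in the ball `B(z, r)`. -/
def pairCount (Ψ : L2 (Config N d)) (r : ℝ) (z : Space d) : ℝ≥0∞ :=
  ∑ i : Fin N, ∑ j ∈ Finset.Ioi i, ∫⁻ y : Fin N → Space d,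
    ‖Ψ (assemble y)‖ₑ ^ 2 * (ballInd r z (y i) * ballInd r z (y j))

lemma sum_sq_eq_diag_add (χ : Fin N → ℝ≥0∞) (hχ : ∀ i, χ i ^ 2 = χ i) :
    (∑ i, χ i) ^ 2 = ∑ i, χ i + 2 * ∑ i, ∑ j ∈ Finset.Ioi i, χ i * χ j := by
  have hswap : ∑ i, ∑ j ∈ Finset.Iio i, χ i * χ j = ∑ i, ∑ j ∈ Finset.Ioi i, χ i * χ j := by
    rw [Finset.sum_comm' (t' := Finset.univ) (s' := fun j => Finset.Ioi j) (by simp)]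
    exact Finset.sum_congr rfl fun i _ => Finset.sum_congr rfl fun j _ => mul_comm _ _
  have hrow : ∀ i, ∑ j, χ i * χ j
      = χ i + (∑ j ∈ Finset.Iio i, χ i * χ j + ∑ j ∈ Finset.Ioi i, χ i * χ j) := by
    intro i
    have hu : (Finset.univ : Finset (Fin N)) = insert i (Finset.Iio i ∪ Finset.Ioi i) := by
      ext j
      simp only [Finset.mem_univ, Finset.mem_insert, Finset.mem_union, Finset.mem_Iio,
        Finset.mem_Ioi, true_iff]
      exact (lt_trichotomy j i).elim (fun h => Or.inr (Or.inl h))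
        fun h => h.elim Or.inl fun h => Or.inr (Or.inr h)
    have hdisj : Disjoint (Finset.Iio i) (Finset.Ioi i) := by
      rw [Finset.disjoint_left]
      intro j hj hj'
      exact lt_asymm (Finset.mem_Iio.1 hj) (Finset.mem_Ioi.1 hj')
    rw [hu, Finset.sum_insert (by simp), Finset.sum_union hdisj, ← sq, hχ]
  rw [sq, Finset.sum_mul_sum, Finset.sum_congr rfl fun i _ => hrow i, Finset.sum_add_distrib,
    Finset.sum_add_distrib, hswap, two_mul]

/-- The mean number of particles in a ball is controlled by its second moment. -/
lemma ballMass_density_sq_le {Ψ : L2 (Config N d)} (hΨ : ‖Ψ‖ = 1) (r : ℝ) (z : Space d) :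
    ballMass (density Ψ) r z ^ 2 ≤ ballMass (density Ψ) r z + 2 * pairCount Ψ r z := by
  have hΨm : Measurable fun y : Fin N → Space d => ‖Ψ (assemble y)‖ₑ :=
    ((Lp.stronglyMeasurable Ψ).measurable.comp measurable_assemble).enorm
  have hmass : ballMass (density Ψ) r z
      = ∫⁻ y : Fin N → Space d, (∑ i, ballInd r z (y i)) * ‖Ψ (assemble y)‖ₑ ^ 2 := by
    rw [ballMass, lintegral_mul_density Ψ (by fun_prop), ← lintegral_finsetSum _ (by fun_prop)]
    exact lintegral_congr fun y => (Finset.sum_mul _ _ _).symm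
  calc ballMass (density Ψ) r z ^ 2
      = (∫⁻ y : Fin N → Space d,
          ((∑ i, ballInd r z (y i)) * ‖Ψ (assemble y)‖ₑ) * ‖Ψ (assemble y)‖ₑ) ^ 2 := by
        rw [hmass]
        simp only [sq, mul_assoc]
    _ ≤ (∫⁻ y : Fin N → Space d, ((∑ i, ballInd r z (y i)) * ‖Ψ (assemble y)‖ₑ) ^ 2)
          * ∫⁻ y : Fin N → Space d, ‖Ψ (assemble y)‖ₑ ^ 2 :=
        sq_lintegral_mul_le (by fun_prop) hΨm
    _ = ∫⁻ y : Fin N → Space d, ((∑ i, ballInd r z (y i)) * ‖Ψ (assemble y)‖ₑ ^ 2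
          + 2 * ∑ i, ∑ j ∈ Finset.Ioi i,
            ‖Ψ (assemble y)‖ₑ ^ 2 * (ballInd r z (y i) * ballInd r z (y j))) := by
        rw [lintegral_enorm_sq_assemble, enorm_eq_one hΨ, one_pow, mul_one]
        refine lintegral_congr fun y => ?_
        rw [mul_pow, sum_sq_eq_diag_add _ fun i => ballInd_sq r z (y i), add_mul, mul_assoc,
          mul_comm (∑ i, ∑ j ∈ Finset.Ioi i, _), Finset.mul_sum]
        simp_rw [Finset.mul_sum]
    _ = _ := by
        rw [lintegral_add_left (by fun_prop), ← hmass, lintegral_const_mul _ (by fun_prop),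
          lintegral_finsetSum _ (by fun_prop), pairCount]
        congr 2
        refine Finset.sum_congr rfl fun i _ => ?_
        rw [lintegral_finsetSum _ (by fun_prop)]

/-- `t ↦ max(t² - t, 0)` is nondecreasing, so the second moment bound passes to `f ≤ ρ_Ψ`. -/
lemma ballMass_sq_le_pairCount {Ψ : L2 (Config N d)} (hΨ : ‖Ψ‖ = 1) {f : Space d → ℝ≥0∞}
    (hf : ∀ x, f x ≤ density Ψ x) (r : ℝ) (z : Space d) :
    ballMass f r z ^ 2
      ≤ 2 * pairCount Ψ r z + min (ballMass f r z ^ 2) (ballMass f r z) := by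
  have hle : ballMass f r z ≤ ballMass (density Ψ) r z := by
    refine lintegral_mono fun x => ?_
    gcongr
    exact hf x
  have hfin : ballMass (density Ψ) r z ≠ ∞ := by
    have : ballMass (density Ψ) r z ≤ ∫⁻ x, density Ψ x := by
      refine lintegral_mono fun x => ?_
      calc ballInd r z x * density Ψ x ≤ 1 * density Ψ x := by
            gcongr
            exact Set.indicator_le_self' (fun _ _ => zero_le) _
        _ = _ := one_mul _
    rw [lintegral_density hΨ] at this
    exact (this.trans_lt (ENNReal.natCast_lt_top N)).ne
  have hsq := ballMass_density_sq_le hΨ r z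
  generalize ballMass (density Ψ) r z = a at hle hfin hsq
  generalize pairCount Ψ r z = J at hsq
  have hb : ballMass f r z ≠ ∞ := (hle.trans_lt hfin.lt_top).ne
  generalize ballMass f r z = b at hle hb
  rcases eq_or_ne J ∞ with rfl | hJ
  · simp
  lift a to NNReal using hfin
  lift b to NNReal using hb
  lift J to NNReal using hJ
  rcases le_total b 1 with hb1 | hb1
  · have : min ((b : ℝ≥0∞) ^ 2) b = (b : ℝ≥0∞) ^ 2 := by
      refine min_eq_left ?_
      rw [sq]
      exact mul_le_of_le_one_left' (by exact_mod_cast hb1)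
    rw [this]
    exact le_add_self
  · have : min ((b : ℝ≥0∞) ^ 2) b = b := by
      refine min_eq_right ?_
      rw [sq]
      exact le_mul_of_one_le_left' (by exact_mod_cast hb1)
    rw [this]
    norm_cast at hle hsq ⊢
    rw [← NNReal.coe_le_coe] at hle hsq hb1 ⊢
    push_cast at hle hsq hb1 ⊢
    nlinarith

lemma ballAverage_pairCount_le {s : ℝ} (hs : 0 < s) (Ψ : L2 (Config N d)) :
    ballAverage (2 * s) (pairCount Ψ)
      ≤ unitVol d * ENNReal.ofReal (2 ^ (2 * s) / (2 * s)) * interactionEnergy s Ψ := by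
  have hm := measurable_enorm_sq_assemble Ψ
  have hpair : ∀ i j : Fin N, Measurable fun a : (Fin N → Space d) × ℝ × Space d =>
      ‖Ψ (assemble a.1)‖ₑ ^ 2 * (ballInd a.2.1 a.2.2 (a.1 i) * ballInd a.2.1 a.2.2 (a.1 j)) := by
    intro i j
    have h1 : Measurable fun a : (Fin N → Space d) × ℝ × Space d => ‖Ψ (assemble a.1)‖ₑ ^ 2 :=
      hm.comp measurable_fst
    fun_prop
  have hint : ∀ i j : Fin N, Measurable fun a : ℝ × Space d => ∫⁻ y : Fin N → Space d,
      ‖Ψ (assemble y)‖ₑ ^ 2 * (ballInd a.1 a.2 (y i) * ballInd a.1 a.2 (y j)) := fun i j =>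
    (hpair i j).lintegral_prod_left'
  have hsum : ballAverage (2 * s) (pairCount Ψ) = ∑ i : Fin N, ∑ j ∈ Finset.Ioi i,
      ballAverage (2 * s) fun r z => ∫⁻ y : Fin N → Space d,
        ‖Ψ (assemble y)‖ₑ ^ 2 * (ballInd r z (y i) * ballInd r z (y j)) := by
    unfold pairCount
    rw [ballAverage_finset_sum _ fun i => Finset.measurable_sum _ fun j _ => hint i j]
    exact Finset.sum_congr rfl fun i _ => ballAverage_finset_sum _ fun j => hint i j
  rw [hsum, interactionEnergy, Finset.mul_sum]
  refine Finset.sum_le_sum fun i _ => ?_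
  rw [Finset.mul_sum]
  refine Finset.sum_le_sum fun j _ => ?_
  have hpi := measurable_particle (d := d) i
  have hpj := measurable_particle (d := d) j
  rw [ballAverage_lintegral (hpair i j), ← lintegral_const_mul _ (by fun_prop),
    ← lintegral_assemble (by fun_prop)]
  refine lintegral_mono fun y => ?_
  simp only [particle_assemble]
  rw [ballAverage_const_mul (by simp)]
  calc _ ≤ ‖Ψ (assemble y)‖ₑ ^ 2 * (unitVol d * ENNReal.ofReal (2 ^ (2 * s) / (2 * s))
          * (1 / ‖y i - y j‖ₑ ^ (2 * s))) := by
        gcongr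
        exact ballKernel_le (by positivity) _ _
    _ = _ := by
        rw [← mul_one_div (‖Ψ (assemble y)‖ₑ ^ 2)]
        ring

lemma riesz_le_ballAverage {p : ℝ} (hd : 0 < d) (hp : 0 < p) {f : Space d → ℝ≥0∞}
    (hf : Measurable f) (hft : ∀ x, f x ≠ ∞) :
    unitVol d * ENNReal.ofReal ((2 ^ d)⁻¹ / p)
        * ∫⁻ x : Space d, ∫⁻ y : Space d, f x * f y / ‖x - y‖ₑ ^ p
      ≤ ballAverage p fun r z => ballMass f r z ^ 2 := by
  have : Nontrivial (Space d) := Module.nontrivial_of_finrank_pos (R := ℝ) (by simpa using hd)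
  have hc : unitVol d * ENNReal.ofReal ((2 ^ d)⁻¹ / p) ≠ ∞ :=
    ENNReal.mul_ne_top unitVol_ne_top ENNReal.ofReal_ne_top
  have hm1 : Measurable fun a : Space d × ℝ × Space d => ∫⁻ y,
      f a.1 * f y * (ballInd a.2.1 a.2.2 a.1 * ballInd a.2.1 a.2.2 y) := by
    have h : Measurable fun b : (Space d × ℝ × Space d) × Space d =>
      f b.1.1 * f b.2 * (ballInd b.1.2.1 b.1.2.2 b.1.1 * ballInd b.1.2.1 b.1.2.2 b.2) := by
      fun_prop
    exact h.lintegral_prod_right'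
  have hexp : (fun r z => ballMass f r z ^ 2) = fun r z => ∫⁻ x, ∫⁻ y,
      f x * f y * (ballInd r z x * ballInd r z y) := by
    ext r z
    rw [sq, ballMass, ← lintegral_mul_const _ (by fun_prop)]
    refine lintegral_congr fun x => ?_
    rw [← lintegral_const_mul _ (by fun_prop)]
    refine lintegral_congr fun y => ?_
    ring
  rw [hexp, ballAverage_lintegral hm1, ← lintegral_const_mul' _ _ hc]
  refine lintegral_mono fun x => ?_
  have hm2 : Measurable fun a : Space d × ℝ × Space d =>
      f x * f a.1 * (ballInd a.2.1 a.2.2 x * ballInd a.2.1 a.2.2 a.1) := by fun_prop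
  simp only
  rw [ballAverage_lintegral hm2, ← lintegral_const_mul' _ _ hc]
  refine lintegral_mono_ae ?_
  -- the lower bound on the kernel fails on the diagonal, which is a null set
  filter_upwards [Measure.ae_ne volume x] with y hy
  rw [ballAverage_const_mul (ENNReal.mul_ne_top (hft x) (hft y)), ← mul_one_div (f x * f y),
    mul_left_comm]
  gcongr
  exact le_ballKernel hp (Ne.symm hy)

/-- A Lieb–Oxford type inequality: up to a local error, the interaction energy dominates the
classical energy of any `f ≤ ρ_Ψ`. -/
theorem exists_riesz_le_interactionEnergy_add (d : ℕ) {s : ℝ} (hs : 0 < s)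
    (hsd : 2 * s < (d : ℝ)) :
    ∃ A : ℝ≥0∞, A ≠ ∞ ∧ ∀ (N : ℕ) (Ψ : L2 (Config N d)), ‖Ψ‖ = 1 →
      ∀ f : Space d → ℝ≥0∞, Measurable f → (∀ x, f x ≠ ∞) → (∀ x, f x ≤ density Ψ x) →
        ∫⁻ x : Space d, ∫⁻ y : Space d, f x * f y / ‖x - y‖ₑ ^ (2 * s)
          ≤ A * (interactionEnergy s Ψ + ∫⁻ x, f x ^ (1 + 2 * s / (d : ℝ))) := by
  have hp : 0 < 2 * s := by linarith
  have hd : 0 < d := Nat.cast_pos.1 (hp.trans hsd)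
  set c₀ := unitVol d * ENNReal.ofReal ((2 ^ d)⁻¹ / (2 * s)) with hc₀
  set c₁ := 2 * (unitVol d * ENNReal.ofReal (2 ^ (2 * s) / (2 * s))) with hc₁
  set c₂ := 4 * (unitVol d ^ 2 * ENNReal.ofReal (1 / (d - 2 * s)))
    + 2 * (unitVol d * ENNReal.ofReal (1 / (2 * s))) with hc₂
  have hc₀0 : c₀ ≠ 0 := by
    refine mul_ne_zero unitVol_ne_zero (ENNReal.ofReal_pos.2 ?_).ne'
    positivity
  have hc₀t : c₀ ≠ ∞ := ENNReal.mul_ne_top unitVol_ne_top ENNReal.ofReal_ne_top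
  have hc₁t : c₁ ≠ ∞ :=
    ENNReal.mul_ne_top (by norm_num) (ENNReal.mul_ne_top unitVol_ne_top ENNReal.ofReal_ne_top)
  have hc₂t : c₂ ≠ ∞ := ENNReal.add_ne_top.2
    ⟨ENNReal.mul_ne_top (by norm_num)
      (ENNReal.mul_ne_top (ENNReal.pow_ne_top unitVol_ne_top) ENNReal.ofReal_ne_top),
    ENNReal.mul_ne_top (by norm_num) (ENNReal.mul_ne_top unitVol_ne_top ENNReal.ofReal_ne_top)⟩
  refine ⟨c₀⁻¹ * (c₁ + c₂), ENNReal.mul_ne_top (ENNReal.inv_ne_top.2 hc₀0)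
    (ENNReal.add_ne_top.2 ⟨hc₁t, hc₂t⟩), fun N Ψ hΨ f hf hft hfρ => ?_⟩
  have hpm : Measurable fun a : ℝ × Space d => 2 * pairCount Ψ a.1 a.2 := by
    refine Measurable.const_mul (Finset.measurable_sum _ fun i _ =>
      Finset.measurable_sum _ fun j _ => ?_) 2
    have h1 : Measurable fun a : (ℝ × Space d) × (Fin N → Space d) => ‖Ψ (assemble a.2)‖ₑ ^ 2 :=
      (measurable_enorm_sq_assemble Ψ).comp measurable_snd
    have h2 : Measurable fun a : (ℝ × Space d) × (Fin N → Space d) =>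
        ‖Ψ (assemble a.2)‖ₑ ^ 2 * (ballInd a.1.1 a.1.2 (a.2 i) * ballInd a.1.1 a.1.2 (a.2 j)) := by
      fun_prop
    exact h2.lintegral_prod_right'
  have key : c₀ * ∫⁻ x : Space d, ∫⁻ y : Space d, f x * f y / ‖x - y‖ₑ ^ (2 * s)
      ≤ (c₁ + c₂) * (interactionEnergy s Ψ + ∫⁻ x, f x ^ (1 + 2 * s / (d : ℝ))) := by
    calc _ ≤ ballAverage (2 * s) fun r z => ballMass f r z ^ 2 := riesz_le_ballAverage hd hp hf hft
      _ ≤ ballAverage (2 * s) fun r z =>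
            2 * pairCount Ψ r z + min (ballMass f r z ^ 2) (ballMass f r z) :=
          ballAverage_mono fun r _ z => ballMass_sq_le_pairCount hΨ hfρ r z
      _ = 2 * ballAverage (2 * s) (pairCount Ψ)
            + ballAverage (2 * s) fun r z => min (ballMass f r z ^ 2) (ballMass f r z) := by
          rw [ballAverage_add hpm, ballAverage_const_mul (by norm_num)]
      _ ≤ c₁ * interactionEnergy s Ψ + c₂ * ∫⁻ x, f x ^ (1 + 2 * s / (d : ℝ)) := by
          refine add_le_add ?_ (ballAverage_min_le hd hp hsd hf hft)
          rw [hc₁, mul_assoc 2]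
          gcongr
          exact ballAverage_pairCount_le hs Ψ
      _ ≤ _ := by
          rw [mul_add]
          gcongr
          · exact le_self_add
          · exact le_add_self
  rw [mul_assoc, ← ENNReal.div_eq_inv_mul, ENNReal.le_div_iff_mul_le (Or.inl hc₀0) (Or.inl hc₀t),
    mul_comm]
  exact key

end ManyBody

section Conclusion

variable {N d : ℕ}

/-- If `c I ≤ (a K)^{1-θ} D^θ` with `D ≤ A (E + I)` and `I` finite, then `I` is bounded by a
multiple of `K + E`: either `I ≤ E`, or `I` can be absorbed because `θ < 1`. -/
lemma le_mul_add_of_mul_le_rpow_mul_rpow {θ : ℝ} (hθ : 0 < θ) (hθ1 : θ < 1) {c A a : ℝ≥0∞}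
    (hc : c ≠ 0) (hct : c ≠ ∞)
    {I K D E : ℝ≥0∞} (hI : I ≠ ∞) (h : c * I ≤ (a * K) ^ (1 - θ) * D ^ θ)
    (hD : D ≤ A * (E + I)) :
    I ≤ ((c⁻¹ * (2 * A) ^ θ) ^ (1 / (1 - θ)) * a + 1) * (K + E) := by
  have hθ' : 0 < 1 - θ := by linarith
  rcases le_total I E with hIE | hIE
  · calc I ≤ 1 * (K + E) := by
          rw [one_mul]
          exact hIE.trans le_add_self
      _ ≤ _ := by
          gcongr
          exact le_add_self
  rcases eq_or_ne I 0 with rfl | hI0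
  · exact zero_le
  have hD2 : D ≤ 2 * A * I := hD.trans (by
    calc A * (E + I) ≤ A * (I + I) := by gcongr
      _ = 2 * A * I := by ring)
  have hIθ0 : I ^ θ ≠ 0 := by simp [hI0, hI]
  have hIθt : I ^ θ ≠ ∞ := ENNReal.rpow_ne_top_of_nonneg hθ.le hI
  have h1 : I ^ (1 - θ) ≤ c⁻¹ * (2 * A) ^ θ * (a * K) ^ (1 - θ) := by
    rw [← ENNReal.mul_le_mul_iff_left hIθ0 hIθt, ← ENNReal.rpow_add _ _ hI0 hI, sub_add_cancel,
      ENNReal.rpow_one]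
    have h2 : I ≤ c⁻¹ * ((a * K) ^ (1 - θ) * D ^ θ) := by
      rw [← ENNReal.div_eq_inv_mul, ENNReal.le_div_iff_mul_le (Or.inl hc) (Or.inl hct), mul_comm]
      exact h
    calc I ≤ c⁻¹ * ((a * K) ^ (1 - θ) * (2 * A * I) ^ θ) := h2.trans (by gcongr)
      _ = _ := by
          rw [ENNReal.mul_rpow_of_nonneg (2 * A) I hθ.le]
          ring
  have h3 := ENNReal.rpow_le_rpow h1 (by positivity : 0 ≤ 1 / (1 - θ))
  rw [ENNReal.mul_rpow_of_nonneg _ _ (by positivity), ← ENNReal.rpow_mul, ← ENNReal.rpow_mul,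
    mul_one_div_cancel hθ'.ne', ENNReal.rpow_one, ENNReal.rpow_one, ← mul_assoc] at h3
  calc I ≤ _ := h3
    _ ≤ _ := by
        gcongr
        · exact le_self_add
        · exact le_self_add

lemma lintegral_density_rpow_le {Ψ : L2 (Config N d)} {q : ℝ} (hq : 0 ≤ q) {B : ℝ≥0∞}
    (h : ∀ M : ℕ, ∫⁻ x, (truncRoot Ψ M x ^ 2) ^ q ≤ B) : ∫⁻ x, density Ψ x ^ q ≤ B := by
  have hm := measurable_truncRoot Ψ
  have hmono : Monotone fun M : ℕ => fun x => (truncRoot Ψ M x ^ 2) ^ q := by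
    intro M M' hM x
    have : truncRoot Ψ M x ≤ truncRoot Ψ M' x := min_le_min le_rfl (Nat.cast_le.2 hM)
    simp only
    gcongr
  have hlim : ∀ x, ⨆ M : ℕ, (truncRoot Ψ M x ^ 2) ^ q = density Ψ x ^ q := by
    intro x
    refine le_antisymm (iSup_le fun M => ?_) ?_
    · gcongr
      exact truncRoot_sq_le_density Ψ M x
    · have ht : Filter.Tendsto (fun M : ℕ => truncRoot Ψ M x) Filter.atTop
          (nhds (density Ψ x ^ (1 / 2 : ℝ))) := by
        have := (tendsto_const_nhds (x := density Ψ x ^ (1 / 2 : ℝ))).min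
          ENNReal.tendsto_nat_nhds_top
        rwa [min_eq_left le_top] at this
      have ht2 := ((ENNReal.continuous_rpow_const (y := q)).tendsto _).comp
        (((ENNReal.continuous_pow 2).tendsto _).comp ht)
      rw [rpow_half_sq] at ht2
      exact le_of_tendsto' ht2 fun M => le_iSup (fun M : ℕ => (truncRoot Ψ M x ^ 2) ^ q) M
  simp_rw [← hlim]
  rw [lintegral_iSup (fun M => by have := hm M; fun_prop) hmono]
  exact iSup_le h

lemma lintegral_truncRoot_lt_top {Ψ : L2 (Config N d)} (hΨ : ‖Ψ‖ = 1) (M : ℕ) {θ : ℝ}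
    (hθ : 0 < θ) : ∫⁻ x, (truncRoot Ψ M x ^ 2) ^ (1 + θ) < ∞ := by
  have hb : ∀ x, (truncRoot Ψ M x ^ 2) ^ (1 + θ) ≤ density Ψ x * ((M : ℝ≥0∞) ^ 2) ^ θ := by
    intro x
    rw [ENNReal.rpow_add_of_nonneg _ _ zero_le_one hθ.le, ENNReal.rpow_one]
    gcongr
    · exact truncRoot_sq_le_density Ψ M x
    · exact min_le_right _ _
  refine (lintegral_mono hb).trans_lt ?_
  rw [lintegral_mul_const _ (measurable_density Ψ), lintegral_density hΨ]
  exact ENNReal.mul_lt_top (ENNReal.natCast_lt_top N)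
    (ENNReal.rpow_lt_top_of_nonneg hθ.le (ENNReal.pow_ne_top (ENNReal.natCast_ne_top M)))

/-- The one-body inequality implies the many-body inequality: apply it to truncations of the root
of the density. -/
theorem liebThirring_of_interpolation {s : ℝ} (hs : 0 < s) (hsd : s < (d : ℝ) / 2) (hs1 : s ≤ 1)
    {C : ℝ} (hC : 0 < C)
    (h : ∀ u : L2 (Space d), MemHs s u →
      ENNReal.ofReal C * ∫⁻ x, ‖u x‖ₑ ^ (2 * (1 + 2 * s / (d : ℝ)))
        ≤ fracForm s u ^ (1 - 2 * s / (d : ℝ)) * rieszEnergy s u ^ (2 * s / (d : ℝ))) :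
    ∃ C' : ℝ, 0 < C' ∧ ∀ N : ℕ, 1 ≤ N → ∀ Ψ : L2 (Config N d), ‖Ψ‖ = 1 → MemHs s Ψ →
      ENNReal.ofReal C' * ∫⁻ x, density Ψ x ^ (1 + 2 * s / (d : ℝ))
        ≤ kineticEnergy s Ψ + interactionEnergy s Ψ := by
  have hd : 0 < (d : ℝ) := by linarith
  obtain ⟨A, hA, hLO⟩ := exists_riesz_le_interactionEnergy_add d hs (by linarith)
  set θ := 2 * s / (d : ℝ) with hθ
  have hθ0 : 0 < θ := by positivity
  have hθ1 : θ < 1 := by rw [hθ, div_lt_one hd]; linarith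
  have hc0 : ENNReal.ofReal C ≠ 0 := (ENNReal.ofReal_pos.2 hC).ne'
  set B : ℝ≥0∞ := ((ENNReal.ofReal C)⁻¹ * (2 * A) ^ θ) ^ (1 / (1 - θ)) * d + 1 with hB
  have hB0 : B ≠ 0 := by simp [hB]
  have hBt : B ≠ ∞ := by
    refine ENNReal.add_ne_top.2
      ⟨ENNReal.mul_ne_top ?_ (ENNReal.natCast_ne_top d), ENNReal.one_ne_top⟩
    refine ENNReal.rpow_ne_top_of_nonneg (by positivity) (ENNReal.mul_ne_top ?_ ?_)
    · exact ENNReal.inv_ne_top.2 hc0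
    · exact ENNReal.rpow_ne_top_of_nonneg hθ0.le (ENNReal.mul_ne_top (by norm_num) hA)
  refine ⟨(B⁻¹).toReal, ENNReal.toReal_pos (ENNReal.inv_ne_zero.2 hBt)
    (ENNReal.inv_ne_top.2 hB0), fun N _ Ψ hΨ _ => ?_⟩
  rw [ENNReal.ofReal_toReal (ENNReal.inv_ne_top.2 hB0), ← ENNReal.div_eq_inv_mul]
  refine ENNReal.div_le_of_le_mul' ?_
  rcases eq_or_ne (kineticEnergy s Ψ) ∞ with hK | hK
  · rw [hK, top_add, ENNReal.mul_top hB0]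
    exact le_top
  refine lintegral_density_rpow_le (by linarith) fun M => ?_
  have hu := enorm_truncRootL2 hΨ M
  have hform := fracForm_truncRootL2_le hs hs1 hΨ M
  have hmem : MemHs s (truncRootL2 hΨ M) :=
    hform.trans_lt (ENNReal.mul_lt_top (ENNReal.natCast_lt_top d) hK.lt_top)
  have hI : ∫⁻ x, ‖truncRootL2 hΨ M x‖ₑ ^ (2 * (1 + θ))
      = ∫⁻ x, (truncRoot Ψ M x ^ 2) ^ (1 + θ) := by
    refine lintegral_congr_ae ?_
    filter_upwards [hu] with x hx
    rw [hx, ENNReal.rpow_mul, ENNReal.rpow_two]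
  have hR : rieszEnergy s (truncRootL2 hΨ M) = ∫⁻ x : Space d, ∫⁻ y : Space d,
      truncRoot Ψ M x ^ 2 * truncRoot Ψ M y ^ 2 / ‖x - y‖ₑ ^ (2 * s) := by
    refine lintegral_congr_ae ?_
    filter_upwards [hu] with x hx
    refine lintegral_congr_ae ?_
    filter_upwards [hu] with y hy
    rw [hx, hy]
  have h1 := h (truncRootL2 hΨ M) hmem
  rw [hI] at h1
  refine le_mul_add_of_mul_le_rpow_mul_rpow hθ0 hθ1 hc0 ENNReal.ofReal_ne_top
    (lintegral_truncRoot_lt_top hΨ M hθ0).ne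
    (D := rieszEnergy s (truncRootL2 hΨ M)) (A := A) (a := d) (h1.trans ?_) ?_
  · gcongr
  · rw [hR]
    exact hLO N Ψ hΨ (fun x => truncRoot Ψ M x ^ 2) ((measurable_truncRoot Ψ M).pow_const 2)
      (fun x => ENNReal.pow_ne_top (truncRoot_ne_top Ψ M x)) (truncRoot_sq_le_density Ψ M)

end Conclusion

end FracLT

end

theorem mainTheorem3 (d : ℕ) (s : ℝ) (hs : 0 < s) (hsd : s < (d : ℝ) / 2) (hs1 : s ≤ 1) :
    (∃ C : ℝ, 0 < C ∧
      ∀ N : ℕ, 1 ≤ N → ∀ Ψ : FracLT.L2 (FracLT.Config N d),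
        ‖Ψ‖ = 1 → FracLT.MemHs s Ψ →
          ENNReal.ofReal C * ∫⁻ x, FracLT.density Ψ x ^ (1 + 2 * s / (d : ℝ))
            ≤ FracLT.kineticEnergy s Ψ + FracLT.interactionEnergy s Ψ)
    ↔
    (∃ C : ℝ, 0 < C ∧
      ∀ u : FracLT.L2 (FracLT.Space d), FracLT.MemHs s u →
          ENNReal.ofReal C * ∫⁻ x, ‖u x‖ₑ ^ (2 * (1 + 2 * s / (d : ℝ)))
            ≤ FracLT.fracForm s u ^ (1 - 2 * s / (d : ℝ))
              * FracLT.rieszEnergy s u ^ (2 * s / (d : ℝ))) := by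
  constructor
  · rintro ⟨C, hC, h⟩
    exact ⟨C / (d + 1), by positivity, FracLT.interpolation_of_liebThirring hs hsd hs1 hC h⟩
  · rintro ⟨C, hC, h⟩
    exact FracLT.liebThirring_of_interpolation hs hsd hs1 hC h
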